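/- Let $\omega>0$, $\alpha,a,b,d_2\in\mathbb{R}$ with $\beta:=-\tfrac{16}{3}\alpha\omega<1$, and let \[ R_0(z)^2=\frac{4\omega}{1+\sqrt{1-\beta}\,\cosh(2\sqrt{\omega}\,z)},\quad R_0>0,\qquad \Lambda_2'=\int_{-\infty}^{\infty}(R_0'(z))^2\,dz,\qquad N=\frac{\Lambda_2'}{2R_0''(0)} . \] For $\epsilon,c,d_1\in\mathbb{R}$ put $\Delta=1+\epsilon^2a^2$ and consider the steady-state system \[ \begin{aligned} r'&=rs,\\ \Delta s'&=-\Delta s^2+\Delta\phi^2-c(\epsilon a s-\phi)-(-\omega+\epsilon^2ab)-(1+\epsilon^2ad_1)r^2-(\alpha+\epsilon^2ad_2)r^4,\\ \Delta\phi'&=-2\Delta s\phi-c(s+\epsilon a\phi)-\epsilon\left[(b+a\omega)+(d_1-a)r^2+(d_2-a\alpha)r^4\right]. \end{aligned} \] For small $\epsilon$ and $c$, let $(r^u,s^u,\phi^u)(z)=(r^u,s^u,\phi^u)(z;c)$ be the branch $r>0$ of the unstable manifold of the equilibrium $(0,s_*,\phi_*)$ with $s_*>0$, i.e. the orbit with $r>0$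 which tends to this equilibrium as $z\to-\infty$, with its phase normalized so that its first zero of $s^u$ is at $z=0$. (More generally, this first zero may be at $z=\tau(c)$, where $\tau(0)=0$ and $\tau$ is differentiable at $c=0$.) Then $N<0$. Moreover, for every $D>0$ there are $\epsilon_0,\delta,\eta,K>0$ such that, for all $0<\epsilon<\epsilon_0$ and $|d_1|\le D$, the normalized orbit exists on $(-\infty,\eta)$ for all $|c|<\delta$, the derivative $\partial_cr^u(0)=\partial_c r^u(0;c)|_{c=0}$ exists and is the same for all choices of the phase $\tau$ as above, and \[ \left|\partial_cr^u(0)-Na\epsilon\right|\le K\epsilon^2 . \] That is, $\partial_cr^u(0)=Na\epsilon+O(\epsilon^2)$, uniformly for $|d_1|\le D$; in particular along any bounded choice $d_1=d_1^*(\epsilon)$ for which the solitary wave exists. -/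

import Mathlib

open Filter Topology Set MeasureTheory

noncomputable section

/-- The real parameters of the perturbed cubic-quintic steady-state equation. -/
structure PCQParams where
  ω : ℝ
  α : ℝ
  ε : ℝ
  a : ℝ
  b : ℝ
  d₁ : ℝ
  d₂ : ℝ

/-- `Δ = 1 + ε²a²`. -/
def PCQParams.Δ (P : PCQParams) : ℝ := 1 + P.ε ^ 2 * P.a ^ 2

/-- The steady-state vector field with wave speed `c` at the point `(r, s, φ)`
(the equation `θ' = φ` decouples and is omitted):
`r' = r s`,
`Δ s' = -Δ s² + Δ φ² - c (ε a s - φ) - (-ω + ε² a b) - (1 + ε² a d₁) r² - (α + ε² a d₂) r⁴`,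
`Δ φ' = -2 Δ s φ - c (s + ε a φ) - ε [(b + a ω) + (d₁ - a) r² + (d₂ - a α) r⁴]`. -/
def PCQParams.field (P : PCQParams) (c : ℝ) (x : ℝ × ℝ × ℝ) : ℝ × ℝ × ℝ :=
  let r := x.1
  let s := x.2.1
  let φ := x.2.2
  (r * s,
    (-P.Δ * s ^ 2 + P.Δ * φ ^ 2 - c * (P.ε * P.a * s - φ) - (-P.ω + P.ε ^ 2 * P.a * P.b)
      - (1 + P.ε ^ 2 * P.a * P.d₁) * r ^ 2 - (P.α + P.ε ^ 2 * P.a * P.d₂) * r ^ 4) / P.Δ,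
    (-2 * P.Δ * s * φ - c * (s + P.ε * P.a * φ)
      - P.ε * ((P.b + P.a * P.ω) + (P.d₁ - P.a) * r ^ 2 + (P.d₂ - P.a * P.α) * r ^ 4)) / P.Δ)

/-- `p` is an equilibrium `(0, s, φ)` with `s > 0`: the state from which the wave emanates
as `z → -∞`. -/
def PCQParams.IsLeftRest (P : PCQParams) (c : ℝ) (p : ℝ × ℝ × ℝ) : Prop :=
  p.1 = 0 ∧ 0 < p.2.1 ∧ P.field c p = 0

/-- `u = (r, s, φ)` parametrizes, for `z < η`, the branch `r > 0` of the unstable manifold of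
the left rest state: it solves the steady-state system and tends to that state
as `z → -∞`. -/
def PCQParams.IsUnstableOrbit (P : PCQParams) (c η : ℝ) (u : ℝ → ℝ × ℝ × ℝ) : Prop :=
  (∀ z < η, HasDerivAt u (P.field c (u z)) z) ∧
  (∀ z < η, 0 < (u z).1) ∧
  ∃ p, P.IsLeftRest c p ∧ Tendsto u atBot (𝓝 p)

/-- The orbit `u`, given for `z < η`, meets the section `{s = 0}` for the first time at
`z = t`. -/
def FirstCrossing (η : ℝ) (u : ℝ → ℝ × ℝ × ℝ) (t : ℝ) : Prop :=
  t < η ∧ (u t).2.1 = 0 ∧ ∀ z < t, 0 < (u z).2.1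

/-- The amplitude `R₀` of the unperturbed wave,
`R₀(z)² = 4ω / (1 + √(1-β) cosh (2√ω z))` with `β = -16αω/3`. -/
def waveR₀ (ω α z : ℝ) : ℝ :=
  √(4 * ω / (1 + √(1 - (-(16 / 3) * α * ω)) * Real.cosh (2 * √ω * z)))

/-- `Λ₂' = ∫ (R₀')²`. -/
def waveLambda₂' (ω α : ℝ) : ℝ := ∫ z : ℝ, (deriv (waveR₀ ω α) z) ^ 2

/-- `N = Λ₂' / (2 R₀''(0))`. -/
def waveN (ω α : ℝ) : ℝ := waveLambda₂' ω α / (2 * iteratedDeriv 2 (waveR₀ ω α) 0)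

end

/-! The combination s + iφ satisfies a complex Riccati equation driven by r². Complete the square,
let σ be the value of s at the rest state, and measure z by q = exp(2σz). The branch r > 0 of the
unstable manifold then reads r² = q y(q), s = σ(1 + q f(q)), φ = ψ - k + σ q g(q) with k = c/(2Δ).
Here y = Y exp(∫₀^q f), and (f, g) solves an equation singular at q = 0. Its continuous solutions
are those of an integral equation on C[0,2], and the phase condition s(0) = 0 becomes f(1) = -1.
This is `profileEq`. It is smooth in (f, g, Y) and in six real coefficients. Its linearization at
the explicit unperturbed wave is the identity minus a Volterra operator, bordered by the translation
mode, hence invertible (`isInvertible_fderiv_profileEq_wave`). The implicit function theorem gives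
the orbits.

The coefficients depend on c, ε, d₁ only through γ = cεa/(2Δ), μ = c², ε and e = εd₁. So the
amplitude at the section is a C² function ρ(γ, μ, ε, e) near 0. At c = 0 only γ moves to first
order, at rate εa/(2Δ). The derivative sought is thus (εa/(2Δ)) ∂_γρ(0, 0, ε, εd₁), which differs
from (εa/2) ∂_γρ(0) by O(ε²), uniformly for |d₁| ≤ D.

It remains to see that ∂_γρ(0) = 2N. Along the γ-axis the equation is the unperturbed oscillator
with damping 2γ. The energy lost up to the crest is, to first order, γ times the integral of R₀'²
over the line. Dividing by the force R₀''(0) at the crest gives the shift of the amplitude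
(`profile_energy`, `profile_energy_deriv`, `wave_amplitude_deriv`).

Arbitrary unstable orbits are translates of the constructed one, because orbits compared at equal r
contract towards each other (`PCQParams.exists_eq_of_tendsto`). The phase is irrelevant to first
order because r' = rs vanishes on the section, so a shift τ changes r by O(τ²). -/

/-- The Banach algebra of real continuous functions on `[0, 2]`. -/
abbrev CI : Type := C(Icc (0 : ℝ) 2, ℝ)

/-! ### Averaging operators on C[0,2] -/

namespace CI

/-- The extension of a continuous function on `[0, 2]` to the line, constant outside. -/
noncomputable def ext (n : CI) : ℝ → ℝ := IccExtend (by norm_num) n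

theorem continuous_ext (n : CI) : Continuous n.ext := n.continuous.Icc_extend'

theorem ext_of_mem (n : CI) {x : ℝ} (hx : x ∈ Icc (0 : ℝ) 2) : n.ext x = n ⟨x, hx⟩ :=
  IccExtend_of_mem _ _ hx

theorem abs_ext_le (n : CI) (x : ℝ) : |n.ext x| ≤ ‖n‖ := n.norm_coe_le_norm _

theorem ext_add (m n : CI) (x : ℝ) : (m + n).ext x = m.ext x + n.ext x := rfl
theorem ext_sub (m n : CI) (x : ℝ) : (m - n).ext x = m.ext x - n.ext x := rfl
theorem ext_mul (m n : CI) (x : ℝ) : (m * n).ext x = m.ext x * n.ext x := rfl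
theorem ext_smul (c : ℝ) (n : CI) (x : ℝ) : (c • n).ext x = c * n.ext x := rfl
theorem ext_pow (n : CI) (k : ℕ) (x : ℝ) : (n ^ k).ext x = n.ext x ^ k := rfl

/-- The identity function of `[0, 2]`. -/
def X : CI := ⟨Subtype.val, continuous_subtype_val⟩

theorem X_apply (q : Icc (0 : ℝ) 2) : X q = q := rfl

theorem ext_X {x : ℝ} (hx : x ∈ Icc (0 : ℝ) 2) : X.ext x = x := by
  rw [ext_of_mem _ hx]; rfl

theorem mul_mem {t : ℝ} (ht : t ∈ Icc (0 : ℝ) 1) (q : Icc (0 : ℝ) 2) :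
    t * q ∈ Icc (0 : ℝ) 2 :=
  ⟨mul_nonneg ht.1 q.2.1, by nlinarith [ht.1, ht.2, q.2.1, q.2.2]⟩

theorem continuous_avg_integrand (k : ℕ) (n : CI) :
    Continuous (Function.uncurry fun (q : Icc (0 : ℝ) 2) (t : ℝ) => t ^ k * n.ext (t * q)) := by
  have := n.continuous_ext
  simp only [Function.uncurry_def]
  fun_prop

theorem intervalIntegrable_avg (k : ℕ) (n : CI) (q : Icc (0 : ℝ) 2) (a b : ℝ) :
    IntervalIntegrable (fun t : ℝ => t ^ k * n.ext (t * q)) volume a b := by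
  have := n.continuous_ext
  exact Continuous.intervalIntegrable (by fun_prop) _ _

theorem abs_integral_avg_le (k : ℕ) (n : CI) (q : Icc (0 : ℝ) 2) {B : ℝ} {j : ℕ}
    (h : ∀ s : Icc (0 : ℝ) 2, |n s| ≤ B * (s : ℝ) ^ j) :
    |∫ t in (0 : ℝ)..1, t ^ k * n.ext (t * q)| ≤ B * (q : ℝ) ^ j / (j + 1) := by
  have hB : ∀ t ∈ Icc (0 : ℝ) 1, ‖t ^ k * n.ext (t * q)‖ ≤ B * (q : ℝ) ^ j * t ^ j := by
    intro t ht
    have h1 := h ⟨t * q, mul_mem ht q⟩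
    rw [Real.norm_eq_abs, abs_mul, ext_of_mem n (mul_mem ht q), abs_of_nonneg (pow_nonneg ht.1 k)]
    calc t ^ k * |n ⟨t * q, mul_mem ht q⟩| ≤ 1 * (B * (t * q) ^ j) :=
          mul_le_mul (pow_le_one₀ ht.1 ht.2) h1 (abs_nonneg _) zero_le_one
      _ = _ := by rw [mul_pow]; ring
  have := intervalIntegral.norm_integral_le_of_norm_le (μ := volume) (zero_le_one' ℝ)
    (Filter.Eventually.of_forall fun t (ht : t ∈ Ioc (0 : ℝ) 1) => hB t ⟨ht.1.le, ht.2⟩)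
    (Continuous.intervalIntegrable (by fun_prop) _ _)
  rw [intervalIntegral.integral_const_mul, integral_pow] at this
  simpa [div_eq_mul_inv] using this

/-- The averaging operator `n ↦ (q ↦ ∫₀¹ tᵏ n(tq) dt)`. -/
noncomputable def avg (k : ℕ) : CI →L[ℝ] CI :=
  LinearMap.mkContinuous
    { toFun := fun n => ⟨fun q => ∫ t in (0 : ℝ)..1, t ^ k * n.ext (t * q),
        intervalIntegral.continuous_parametric_intervalIntegral_of_continuous'
          (continuous_avg_integrand k n) 0 1⟩
      map_add' := fun m n => by
        ext q
        simp only [ContinuousMap.coe_mk, ContinuousMap.add_apply, ext_add, mul_add]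
        exact intervalIntegral.integral_add (intervalIntegrable_avg k m q 0 1)
          (intervalIntegrable_avg k n q 0 1)
      map_smul' := fun c n => by
        ext q
        simp only [ContinuousMap.coe_mk, ContinuousMap.smul_apply, ext_smul, RingHom.id_apply,
          smul_eq_mul, ← intervalIntegral.integral_const_mul]
        congr 1; ext t; ring }
    1 (fun n => by
      rw [ContinuousMap.norm_le _ (by positivity)]
      intro q
      have := abs_integral_avg_le k n q (B := ‖n‖) (j := 0)
        (fun s => by simpa using n.norm_coe_le_norm s)
      simpa using this)

theorem avg_apply (k : ℕ) (n : CI) (q : Icc (0 : ℝ) 2) :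
    avg k n q = ∫ t in (0 : ℝ)..1, t ^ k * n.ext (t * q) := rfl

theorem abs_avg_le (k : ℕ) (n : CI) (q : Icc (0 : ℝ) 2) {B : ℝ} {j : ℕ}
    (h : ∀ s : Icc (0 : ℝ) 2, |n s| ≤ B * (s : ℝ) ^ j) :
    |avg k n q| ≤ B * (q : ℝ) ^ j / (j + 1) := abs_integral_avg_le k n q h

/-- The primitive `n ↦ (q ↦ ∫₀^q n)`. -/
noncomputable def prim : CI →L[ℝ] CI := ContinuousLinearMap.mul ℝ CI X ∘L avg 0

theorem prim_apply (n : CI) (q : Icc (0 : ℝ) 2) : prim n q = q * avg 0 n q := rfl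

/-- `avg k n = g` as soon as `(k + 1) g + x g' = n`. -/
theorem avg_eq_of_hasDerivAt (k : ℕ) (n : CI) {g g' : ℝ → ℝ}
    (hg : ∀ x ∈ Icc (0 : ℝ) 2, HasDerivAt g (g' x) x)
    (h : ∀ x : Icc (0 : ℝ) 2, n x = (k + 1) * g x + x * g' x) (q : Icc (0 : ℝ) 2) :
    avg k n q = g q := by
  rw [avg_apply]
  have key : ∀ t ∈ uIcc (0 : ℝ) 1,
      HasDerivAt (fun t : ℝ => t ^ (k + 1) * g (t * q)) (t ^ k * n.ext (t * q)) t := by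
    intro t ht
    rw [uIcc_of_le zero_le_one] at ht
    have hm := mul_mem ht q
    have h1 : HasDerivAt (fun t : ℝ => g (t * q)) (g' (t * q) * (1 * q)) t :=
      (hg _ hm).comp t ((hasDerivAt_id t).mul_const (q : ℝ))
    have h2 := (hasDerivAt_pow (k + 1) t).mul h1
    refine h2.congr_deriv ?_
    rw [ext_of_mem n hm, h ⟨t * q, hm⟩]
    push_cast [pow_succ]
    ring
  rw [intervalIntegral.integral_eq_sub_of_hasDerivAt key (intervalIntegrable_avg k n q 0 1)]
  simp

theorem prim_eq_of_hasDerivAt (n : CI) {g : ℝ → ℝ}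
    (hg : ∀ x : Icc (0 : ℝ) 2, HasDerivAt g (n x) x) (q : Icc (0 : ℝ) 2) :
    prim n q = g q - g 0 := by
  rw [prim_apply, avg_apply, ← intervalIntegral.integral_const_mul]
  have key : ∀ t ∈ uIcc (0 : ℝ) 1,
      HasDerivAt (fun t : ℝ => g (t * q)) (q * (t ^ 0 * n.ext (t * q))) t := by
    intro t ht
    rw [uIcc_of_le zero_le_one] at ht
    have hm := mul_mem ht q
    have h1 : HasDerivAt (fun t : ℝ => g (t * q)) (n ⟨t * q, hm⟩ * (1 * q)) t :=
      HasDerivAt.comp t (hg ⟨t * q, hm⟩) ((hasDerivAt_id t).mul_const (q : ℝ))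
    refine h1.congr_deriv ?_
    rw [ext_of_mem n hm]; ring
  rw [intervalIntegral.integral_eq_sub_of_hasDerivAt key
    ((intervalIntegrable_avg 0 n q 0 1).const_mul _)]
  simp

theorem mul_pow_avg_eq_integral (k : ℕ) (n : CI) (q : Icc (0 : ℝ) 2) :
    (q : ℝ) ^ (k + 1) * avg k n q = ∫ s in (0 : ℝ)..q, s ^ k * n.ext s := by
  have := intervalIntegral.smul_integral_comp_mul_right (a := 0) (b := 1)
    (fun s => s ^ k * n.ext s) (q : ℝ)
  simp only [zero_mul, one_mul, smul_eq_mul] at this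
  rw [← this, avg_apply, pow_succ', mul_assoc, ← intervalIntegral.integral_const_mul]
  congr 2; ext t; ring

/-- The averages invert the singular operator G ↦ xG' + (k+1)G. Away from x = 0 this is the quotient
rule for x^{-(k+1)} ∫₀^x sᵏ n(s) ds. -/
theorem hasDerivAt_ext_avg (k : ℕ) (n : CI) {x : ℝ} (hx : x ∈ Ioo (0 : ℝ) 2) :
    HasDerivAt (avg k n).ext ((n.ext x - (k + 1) * (avg k n).ext x) / x) x := by
  have hc : Continuous fun s => s ^ k * n.ext s := by
    have := n.continuous_ext
    fun_prop
  have h1 : HasDerivAt (fun x => ∫ s in (0 : ℝ)..x, s ^ k * n.ext s) (x ^ k * n.ext x) x :=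
    intervalIntegral.integral_hasDerivAt_right (hc.intervalIntegrable _ _)
      hc.stronglyMeasurable.stronglyMeasurableAtFilter hc.continuousAt
  have hx0 : x ≠ 0 := hx.1.ne'
  have heq : ∀ y ∈ Ioo (0 : ℝ) 2, (avg k n).ext y = (∫ s in (0 : ℝ)..y, s ^ k * n.ext s) / y ^ (k + 1) := by
    intro y hy
    rw [ext_of_mem _ (Ioo_subset_Icc_self hy), eq_div_iff (pow_ne_zero _ hy.1.ne'), mul_comm]
    exact mul_pow_avg_eq_integral k n ⟨y, Ioo_subset_Icc_self hy⟩
  have h2 := h1.div (hasDerivAt_pow (k + 1) x) (pow_ne_zero _ hx0)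
  refine (h2.congr_of_eventuallyEq ?_).congr_deriv ?_
  · filter_upwards [Ioo_mem_nhds hx.1 hx.2] with y hy using heq y hy
  · rw [heq x hx]
    simp only [Nat.add_sub_cancel]
    push_cast
    field_simp
    ring

theorem hasDerivAt_ext_prim (n : CI) {x : ℝ} (hx : x ∈ Ioo (0 : ℝ) 2) :
    HasDerivAt (prim n).ext (n.ext x) x := by
  have h := (hasDerivAt_id x).mul (hasDerivAt_ext_avg 0 n hx)
  refine (h.congr_of_eventuallyEq ?_).congr_deriv ?_
  · filter_upwards [Ioo_mem_nhds hx.1 hx.2] with y hy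
    rw [ext_of_mem _ (Ioo_subset_Icc_self hy)]
    simp [prim_apply, ext_of_mem _ (Ioo_subset_Icc_self hy)]
  · have := hx.1.ne'
    simp
    field_simp
    ring

/-! ### Volterra operators and invertibility of 1 - V -/

/-- An operator of Volterra type: it gains one power of the variable. -/
def IsVolterra (V : CI →L[ℝ] CI) : Prop :=
  ∃ C : ℝ, 0 ≤ C ∧ ∀ (u : CI) (B : ℝ) (k : ℕ), (∀ s : Icc (0 : ℝ) 2, |u s| ≤ B * (s : ℝ) ^ k) →
    ∀ q : Icc (0 : ℝ) 2, |V u q| ≤ C * B * (q : ℝ) ^ (k + 1) / (k + 1)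

theorem IsVolterra.add {V W : CI →L[ℝ] CI} (hV : IsVolterra V) (hW : IsVolterra W) :
    IsVolterra (V + W) := by
  obtain ⟨C, hC, hV⟩ := hV
  obtain ⟨D, hD, hW⟩ := hW
  refine ⟨C + D, by positivity, fun u B k hu q => ?_⟩
  have h1 := hV u B k hu q
  have h2 := hW u B k hu q
  calc |(V + W) u q| ≤ |V u q| + |W u q| := abs_add_le _ _
    _ ≤ _ := add_le_add h1 h2
    _ = _ := by ring

theorem IsVolterra.smul {V : CI →L[ℝ] CI} (c : ℝ) (hV : IsVolterra V) : IsVolterra (c • V) := by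
  obtain ⟨C, hC, hV⟩ := hV
  refine ⟨|c| * C, by positivity, fun u B k hu q => ?_⟩
  have h1 := hV u B k hu q
  calc |(c • V) u q| = |c| * |V u q| := by simp [abs_mul]
    _ ≤ |c| * _ := mul_le_mul_of_nonneg_left h1 (abs_nonneg _)
    _ = _ := by ring

theorem bound_nonneg {u : CI} {B : ℝ} {k : ℕ} (h : ∀ s : Icc (0 : ℝ) 2, |u s| ≤ B * (s : ℝ) ^ k) :
    0 ≤ B := by
  have := (abs_nonneg _).trans (h ⟨1, by norm_num, by norm_num⟩)
  simpa using this

/-- The factor q supplies the extra power, and averaging a function bounded by s^{k+1} supplies a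
denominator k + 2, better than the required k + 1. -/
theorem isVolterra_avg_mul_X_mul (j : ℕ) (w : CI) :
    IsVolterra (avg j ∘L ContinuousLinearMap.mul ℝ CI (X * w)) := by
  refine ⟨‖w‖, norm_nonneg _, fun u B k hu q => ?_⟩
  have hB := bound_nonneg hu
  have h1 : ∀ s : Icc (0 : ℝ) 2, |(X * w * u) s| ≤ ‖w‖ * B * (s : ℝ) ^ (k + 1) := by
    intro s
    have h2 := w.norm_coe_le_norm s
    rw [Real.norm_eq_abs] at h2
    simp only [ContinuousMap.mul_apply, X_apply, abs_mul, abs_of_nonneg s.2.1]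
    calc (s : ℝ) * |w s| * |u s| ≤ s * ‖w‖ * (B * (s : ℝ) ^ k) :=
          mul_le_mul (mul_le_mul_of_nonneg_left h2 s.2.1) (hu s) (abs_nonneg _)
            (mul_nonneg s.2.1 (norm_nonneg _))
      _ = _ := by ring
  refine (abs_avg_le j _ q h1).trans ?_
  have : 0 ≤ ‖w‖ * B * (q : ℝ) ^ (k + 1) := by have := q.2.1; positivity
  push_cast
  gcongr
  linarith

/-- Here the primitive supplies both the power and the denominator k + 1; the outer average only has
to be bounded by 1. -/
theorem isVolterra_avg_mul_prim (j : ℕ) (w : CI) :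
    IsVolterra (avg j ∘L ContinuousLinearMap.mul ℝ CI w ∘L prim) := by
  refine ⟨‖w‖, norm_nonneg _, fun u B k hu q => ?_⟩
  have hB := bound_nonneg hu
  have h1 : ∀ s : Icc (0 : ℝ) 2, |(w * prim u) s| ≤ ‖w‖ * B / (k + 1) * (s : ℝ) ^ (k + 1) := by
    intro s
    have h2 := w.norm_coe_le_norm s
    rw [Real.norm_eq_abs] at h2
    have h3 := abs_avg_le 0 u s hu
    rw [ContinuousMap.mul_apply, prim_apply, abs_mul, abs_mul, abs_of_nonneg s.2.1]
    calc |w s| * (s * |avg 0 u s|) ≤ ‖w‖ * (s * (B * (s : ℝ) ^ k / (k + 1))) := by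
          gcongr
          exacts [mul_nonneg s.2.1 (abs_nonneg _), s.2.1]
      _ = _ := by ring
  refine (abs_avg_le j _ q h1).trans ?_
  have : 0 ≤ ‖w‖ * B / (k + 1) * (q : ℝ) ^ (k + 1) := by have := q.2.1; positivity
  calc _ ≤ ‖w‖ * B / (k + 1) * (q : ℝ) ^ (k + 1) := div_le_self this (by push_cast; linarith [k.cast_nonneg (α := ℝ)])
    _ = _ := by ring

/-- The denominators 1, 2, ..., n met in n successive applications multiply to n!. -/
theorem IsVolterra.abs_pow_le {V : CI →L[ℝ] CI} {C : ℝ}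
    (hV : ∀ (u : CI) (B : ℝ) (k : ℕ), (∀ s : Icc (0 : ℝ) 2, |u s| ≤ B * (s : ℝ) ^ k) →
      ∀ q : Icc (0 : ℝ) 2, |V u q| ≤ C * B * (q : ℝ) ^ (k + 1) / (k + 1)) (u : CI) (n : ℕ) :
    ∀ q : Icc (0 : ℝ) 2, |(V ^ n) u q| ≤ C ^ n / n.factorial * ‖u‖ * (q : ℝ) ^ n := by
  induction n with
  | zero => intro q; simpa using u.norm_coe_le_norm q
  | succ n ih =>
    intro q
    have := hV _ _ n ih q
    rw [pow_succ']
    refine this.trans_eq ?_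
    rw [Nat.factorial_succ]
    push_cast
    field_simp
    ring

/-- Since ‖Vⁿ‖ ≤ (2C)ⁿ/n!, some power has norm below 1. Then 1 - Vⁿ is a unit, and 1 - V is a factor
of it that commutes with the geometric sum. -/
theorem IsVolterra.bijective_one_sub {V : CI →L[ℝ] CI} (hV : IsVolterra V) :
    Function.Bijective (1 - V : CI →L[ℝ] CI) := by
  obtain ⟨C, hC, hV⟩ := hV
  have hb : ∀ n, ‖V ^ n‖ ≤ (2 * C) ^ n / n.factorial := by
    intro n
    refine ContinuousLinearMap.opNorm_le_bound _ (by positivity) fun u => ?_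
    rw [ContinuousMap.norm_le _ (by positivity)]
    intro q
    refine (IsVolterra.abs_pow_le hV u n q).trans ?_
    have : (q : ℝ) ^ n ≤ 2 ^ n := pow_le_pow_left₀ q.2.1 q.2.2 n
    calc C ^ n / n.factorial * ‖u‖ * (q : ℝ) ^ n ≤ C ^ n / n.factorial * ‖u‖ * 2 ^ n := by gcongr
      _ = _ := by rw [mul_pow]; ring
  obtain ⟨n, hn⟩ := ((FloorSemiring.tendsto_pow_div_factorial_atTop (2 * C)).eventually_lt_const
    (zero_lt_one)).exists
  have hn' : ‖V ^ n‖ < 1 := (hb n).trans_lt hn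
  have hu : IsUnit (1 - V ^ n) := isUnit_one_sub_of_norm_lt_one (R := CI →L[ℝ] CI) hn'
  have hu' : IsUnit ((1 - V) * ∑ i ∈ Finset.range n, V ^ i) := by rwa [mul_neg_geom_sum]
  have hc : Commute (1 - V) (∑ i ∈ Finset.range n, V ^ i) :=
    (Commute.one_left _).sub_left (Commute.sum_right _ _ _ fun i _ => (Commute.refl V).pow_right i)
  have h1 : IsUnit (1 - V) := (hc.isUnit_mul_iff.1 hu').1
  obtain ⟨⟨a, b, hab, hba⟩, rfl⟩ := h1
  refine Function.bijective_iff_has_inverse.2 ⟨b, fun x => ?_, fun x => ?_⟩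
  · exact congrArg (fun T : CI →L[ℝ] CI => T x) hba
  · exact congrArg (fun T : CI →L[ℝ] CI => T x) hab

end CI

/-! ### The profile equation and its linearization -/

/-- The squared amplitude divided by `q`, `Y exp (∫₀^q f)`. -/
noncomputable def amp (f : CI) (Y : ℝ) : CI := Y • NormedSpace.exp (CI.prim f)

theorem amp_apply (f : CI) (Y : ℝ) (q : Icc (0 : ℝ) 2) :
    amp f Y q = Y * Real.exp (CI.prim f q) := by
  have h := NormedSpace.map_exp
    ((Pi.evalRingHom (fun _ : Icc (0 : ℝ) 2 => ℝ) q).comp ContinuousMap.coeFnRingHom)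
    (continuous_eval_const (F := CI) q) (CI.prim f)
  rw [Real.exp_eq_exp_ℝ]
  exact congrArg (Y * ·) h

/-- The real part of the nonlinearity in the profile equation. -/
noncomputable def profileRe (l : Fin 6 → ℝ) (f g y : CI) : CI :=
  CI.X * (f ^ 2 - g ^ 2) + l 2 • y + l 4 • (CI.X * y ^ 2) + (2 * l 0) • f - (2 * l 1) • g

/-- The imaginary part of the nonlinearity in the profile equation. -/
noncomputable def profileIm (l : Fin 6 → ℝ) (f g y : CI) : CI :=
  (2 : ℝ) • (CI.X * (f * g)) + l 3 • y + l 5 • (CI.X * y ^ 2) + (2 * l 0) • g + (2 * l 1) • f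

/-- The point `q = 1` of `[0, 2]`. -/
def onePt : Icc (0 : ℝ) 2 := ⟨1, by norm_num, by norm_num⟩

/-- The profile equation of the unstable manifold in the variable `q = exp (2σz)`, together with
the condition that the section is met at `q = 1`. The unknown is `(f, g, Y)`. -/
noncomputable def profileEq (x : (Fin 6 → ℝ) × (CI × CI × ℝ)) : CI × CI × ℝ :=
  (x.2.1 + (1 / 2 : ℝ) • CI.avg 1 (profileRe x.1 x.2.1 x.2.2.1 (amp x.2.1 x.2.2.2)),
    x.2.2.1 + (1 / 2 : ℝ) • CI.avg 1 (profileIm x.1 x.2.1 x.2.2.1 (amp x.2.1 x.2.2.2)),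
    x.2.1 onePt + 1)

theorem contDiff_exp_CI {n : WithTop ℕ∞} : ContDiff ℝ n (NormedSpace.exp : CI → CI) :=
  contDiff_iff_contDiffAt.2 fun x => (NormedSpace.exp_analytic (𝕂 := ℝ) x).contDiffAt

theorem contDiff_amp {n : WithTop ℕ∞} : ContDiff ℝ n (fun x : CI × ℝ => amp x.1 x.2) := by
  unfold amp
  exact contDiff_snd.smul (contDiff_exp_CI.comp (CI.prim.contDiff.comp contDiff_fst))

theorem contDiff_profileEq {n : WithTop ℕ∞} : ContDiff ℝ n profileEq := by
  have hA : ContDiff ℝ n (fun x : (Fin 6 → ℝ) × (CI × CI × ℝ) => amp x.2.1 x.2.2.2) :=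
    contDiff_amp.comp (by fun_prop : ContDiff ℝ n (fun x : (Fin 6 → ℝ) × (CI × CI × ℝ) => (x.2.1, x.2.2.2)))
  have he : ContDiff ℝ n (fun x : (Fin 6 → ℝ) × (CI × CI × ℝ) => x.2.1 onePt) :=
    (ContinuousMap.evalCLM ℝ onePt : CI →L[ℝ] ℝ).contDiff.comp
      (g := ContinuousMap.evalCLM ℝ onePt) (contDiff_fst.comp contDiff_snd)
  have hl : ∀ i, ContDiff ℝ n (fun x : (Fin 6 → ℝ) × (CI × CI × ℝ) => x.1 i) := fun i => by fun_prop
  have h0 := hl 0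
  have h1 := hl 1
  have h2 := hl 2
  have h3 := hl 3
  have h4 := hl 4
  have h5 := hl 5
  unfold profileEq profileRe profileIm
  refine ContDiff.prodMk ?_ (ContDiff.prodMk ?_ ?_)
  · fun_prop
  · fun_prop
  · fun_prop

/-- The unperturbed parameters. -/
def baseParam (P Q : ℝ) : Fin 6 → ℝ := ![0, 0, P, 0, Q, 0]

/-- The equations for a and b decouple because g and the odd-indexed coefficients vanish at the base
point. The variation of the amplitude is logarithmic: y times (∫a + t/Y). The derivative is found by
differentiating along a straight line. -/
theorem fderiv_profileEq_inr (P Q Y : ℝ) (f : CI) (a b : CI) (t : ℝ) (hY : Y ≠ 0) :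
    fderiv ℝ profileEq (baseParam P Q, f, 0, Y) (0, a, b, t) =
      (a + (1 / 2 : ℝ) • CI.avg 1 ((2 : ℝ) • (CI.X * f * a) +
          (P • amp f Y + (2 * Q) • (CI.X * amp f Y ^ 2)) * (CI.prim a + ContinuousMap.const _ (t / Y))),
        b + CI.avg 1 (CI.X * f * b), a onePt) := by
  have hF : HasFDerivAt profileEq (fderiv ℝ profileEq (baseParam P Q, f, 0, Y))
      (baseParam P Q, f, 0, Y) :=
    ((contDiff_profileEq (n := 1)).differentiable one_ne_zero _).hasFDerivAt
  have ha : HasDerivAt (fun s : ℝ => f + s • a) a 0 := by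
    simpa using ((hasDerivAt_id (0 : ℝ)).smul_const a).const_add f
  have hb : HasDerivAt (fun s : ℝ => s • b) b 0 := by
    simpa using ((hasDerivAt_id (0 : ℝ)).smul_const b)
  have ht : HasDerivAt (fun s : ℝ => Y + s * t) t 0 := by
    simpa using ((hasDerivAt_id (0 : ℝ)).mul_const t).const_add Y
  have hline : HasDerivAt (fun s : ℝ => (baseParam P Q, f + s • a, s • b, Y + s * t))
      (0, a, b, t) 0 :=
    (hasDerivAt_const _ _).prodMk (ha.prodMk (hb.prodMk ht))
  have h1 := HasFDerivAt.comp_hasDerivAt_of_eq (0 : ℝ) hF hline (by simp)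
  have hE : HasDerivAt (fun s : ℝ => NormedSpace.exp (CI.prim (f + s • a)))
      (NormedSpace.exp (CI.prim f) * CI.prim a) 0 := by
    have h2 : HasDerivAt (fun s : ℝ => CI.prim (f + s • a)) (CI.prim a) 0 :=
      CI.prim.hasFDerivAt.comp_hasDerivAt _ ha
    have h3 := HasFDerivAt.comp_hasDerivAt_of_eq (0 : ℝ)
      (hasFDerivAt_exp (𝕂 := ℝ) (x := CI.prim f)) h2 (by simp)
    refine h3.congr_deriv ?_
    simp
  have hy : HasDerivAt (fun s : ℝ => amp (f + s • a) (Y + s * t))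
      (amp f Y * (CI.prim a + ContinuousMap.const _ (t / Y))) 0 := by
    refine (ht.smul hE).congr_deriv ?_
    ext q
    simp [amp]
    field_simp
  have hX : HasDerivAt (fun _ : ℝ => CI.X) 0 0 := hasDerivAt_const _ _
  have hRe : HasDerivAt (fun s : ℝ => profileRe (baseParam P Q) (f + s • a) (s • b)
      (amp (f + s • a) (Y + s * t)))
      ((2 : ℝ) • (CI.X * f * a) +
          (P • amp f Y + (2 * Q) • (CI.X * amp f Y ^ 2)) * (CI.prim a + ContinuousMap.const _ (t / Y))) 0 := by
    have := ((hX.mul ((ha.mul ha).sub (hb.mul hb))).add (hy.const_smul P)).add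
      ((hX.mul (hy.mul hy)).const_smul Q)
    refine (this.congr_of_eventuallyEq (Eventually.of_forall fun s => ?_)).congr_deriv ?_
    · simp [profileRe, baseParam, pow_two]
    · ext q
      simp
      ring
  have hIm : HasDerivAt (fun s : ℝ => profileIm (baseParam P Q) (f + s • a) (s • b)
      (amp (f + s • a) (Y + s * t))) ((2 : ℝ) • (CI.X * f * b)) 0 := by
    have := (hX.mul (ha.mul hb)).const_smul (2 : ℝ)
    refine (this.congr_of_eventuallyEq (Eventually.of_forall fun s => ?_)).congr_deriv ?_
    · simp [profileIm, baseParam]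
    · ext q
      simp
      ring
  have hev : HasDerivAt (fun s : ℝ => (f + s • a) onePt + 1) (a onePt) 0 :=
    ((ContinuousMap.evalCLM ℝ onePt).hasFDerivAt.comp_hasDerivAt _ ha).add_const _
  have h2 := (ha.add (((CI.avg 1).hasFDerivAt.comp_hasDerivAt _ hRe).const_smul (1 / 2 : ℝ))).prodMk
    ((hb.add (((CI.avg 1).hasFDerivAt.comp_hasDerivAt _ hIm).const_smul (1 / 2 : ℝ))).prodMk hev)
  have h3 := h1.unique h2
  rw [h3]
  congr 2
  rw [map_smul, smul_smul]
  norm_num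

/-- A bordering argument. The hypothesis says that v, with logarithmic variation 1 of Y, is
annihilated by the first component. Subtracting (t/Y)v from a absorbs the dependence on t and leaves
1 - V with V Volterra. The scalar t is then determined by the value at q = 1, where v does not
vanish. -/
theorem isInvertible_fderiv_profileEq (P Q Y : ℝ) (f v : CI) (hY : Y ≠ 0) (hv1 : v onePt ≠ 0)
    (hv : v + (1 / 2 : ℝ) • CI.avg 1 ((2 : ℝ) • (CI.X * f * v) +
      (P • amp f Y + (2 * Q) • (CI.X * amp f Y ^ 2)) * (CI.prim v + 1)) = 0) :
    (fderiv ℝ profileEq (baseParam P Q, f, 0, Y) ∘L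
      .inr ℝ (Fin 6 → ℝ) (CI × CI × ℝ)).IsInvertible := by
  set w : CI := P • amp f Y + (2 * Q) • (CI.X * amp f Y ^ 2) with hw
  set D := fderiv ℝ profileEq (baseParam P Q, f, 0, Y) ∘L .inr ℝ (Fin 6 → ℝ) (CI × CI × ℝ) with hD
  set V₁ : CI →L[ℝ] CI := (-1 : ℝ) • (CI.avg 1 ∘L ContinuousLinearMap.mul ℝ CI (CI.X * f)) +
    (-1 / 2 : ℝ) • (CI.avg 1 ∘L ContinuousLinearMap.mul ℝ CI w ∘L CI.prim) with hV₁
  set V₂ : CI →L[ℝ] CI := (-1 : ℝ) • (CI.avg 1 ∘L ContinuousLinearMap.mul ℝ CI (CI.X * f)) with hV₂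
  have hB₁ : Function.Bijective (1 - V₁ : CI →L[ℝ] CI) :=
    (((CI.isVolterra_avg_mul_X_mul 1 f).smul _).add
      ((CI.isVolterra_avg_mul_prim 1 w).smul _)).bijective_one_sub
  have hB₂ : Function.Bijective (1 - V₂ : CI →L[ℝ] CI) :=
    ((CI.isVolterra_avg_mul_X_mul 1 f).smul _).bijective_one_sub
  have hconst : ∀ c : ℝ, (ContinuousMap.const (Icc (0 : ℝ) 2) c : CI) = c • 1 := fun c => by
    ext q; simp
  have e₁ : ∀ (a : CI) (c : ℝ), a + (1 / 2 : ℝ) • CI.avg 1 ((2 : ℝ) • (CI.X * f * a) +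
      w * (CI.prim a + ContinuousMap.const _ c)) = (1 - V₁ : CI →L[ℝ] CI) (a - c • v) := by
    intro a c
    have h1 : ∀ a : CI, (1 - V₁ : CI →L[ℝ] CI) a = a + (1 / 2 : ℝ) • CI.avg 1 ((2 : ℝ) • (CI.X * f * a) +
      w * CI.prim a) := by
      intro a
      simp only [hV₁, hV₂, sub_apply, add_apply,
        smul_apply, ContinuousLinearMap.comp_apply,
        ContinuousLinearMap.mul_apply', one_apply_eq_self, map_add, map_smul]
      module
    have h2 : (1 - V₁ : CI →L[ℝ] CI) v = - (1 / 2 : ℝ) • CI.avg 1 w := by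
      rw [h1]
      rw [mul_add, mul_one, ← add_assoc, map_add, smul_add, ← add_assoc] at hv
      rw [neg_smul]
      exact eq_neg_of_add_eq_zero_left hv
    rw [map_sub, map_smul, h1, h2, hconst, mul_add, ← add_assoc, map_add, mul_smul_comm, mul_one,
      map_smul]
    module
  have e₂ : ∀ b : CI, b + CI.avg 1 (CI.X * f * b) = (1 - V₂ : CI →L[ℝ] CI) b := by
    intro b
    simp only [hV₂, sub_apply,
        smul_apply, ContinuousLinearMap.comp_apply,
        ContinuousLinearMap.mul_apply', one_apply_eq_self]
    module
  have hDa : ∀ (a b : CI) (t : ℝ), D (a, b, t) =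
      ((1 - V₁ : CI →L[ℝ] CI) (a - (t / Y) • v), (1 - V₂ : CI →L[ℝ] CI) b, a onePt) := by
    intro a b t
    rw [← e₁, ← e₂]
    exact fderiv_profileEq_inr P Q Y f a b t hY
  have hbij : Function.Bijective D := by
    constructor
    · rw [injective_iff_map_eq_zero]
      rintro ⟨a, b, t⟩ h
      rw [hDa, Prod.mk_eq_zero, Prod.mk_eq_zero] at h
      obtain ⟨h1, h2, h3⟩ := h
      have h4 := (injective_iff_map_eq_zero _).1 hB₁.1 _ h1
      have h5 := (injective_iff_map_eq_zero _).1 hB₂.1 _ h2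
      have h6 : a = (t / Y) • v := sub_eq_zero.1 h4
      have ht : t / Y = 0 := by
        rw [h6, ContinuousMap.smul_apply, smul_eq_mul] at h3
        exact (mul_eq_zero.1 h3).resolve_right hv1
      have ht0 : t = 0 := (div_eq_zero_iff.1 ht).resolve_right hY
      rw [h6, h5, ht, ht0]
      simp
    · rintro ⟨c, d, e⟩
      obtain ⟨a, ha⟩ := hB₁.2 c
      obtain ⟨b, hb⟩ := hB₂.2 d
      refine ⟨(a + ((e - a onePt) / v onePt) • v, b, (e - a onePt) / v onePt * Y), ?_⟩
      rw [hDa, mul_div_assoc, div_self hY, mul_one, add_sub_cancel_right, ha, hb]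
      simp [hv1]
  exact ⟨ContinuousLinearEquiv.ofBijective D (LinearMap.ker_eq_bot.2 hbij.1)
    (LinearMap.range_eq_top.2 hbij.2), rfl⟩

/-! ### The unperturbed wave in the variable q -/

/-- The denominator of the unperturbed profile. -/
def waveDen (κ q : ℝ) : ℝ := 2 * q + κ * (1 + q ^ 2)

theorem waveDen_pos {κ q : ℝ} (hκ : 0 < κ) (hq : 0 ≤ q) : 0 < waveDen κ q := by
  unfold waveDen; positivity

theorem hasDerivAt_waveDen (κ q : ℝ) : HasDerivAt (waveDen κ) (2 + 2 * κ * q) q := by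
  have := ((hasDerivAt_id q).const_mul 2).add (((hasDerivAt_pow 2 q).const_add 1).const_mul κ)
  refine this.congr_deriv ?_
  simp; ring

/-- The unperturbed logarithmic derivative profile. -/
noncomputable def waveF (κ q : ℝ) : ℝ := -(2 + 2 * κ * q) / waveDen κ q

/-- The derivative of `q ↦ q waveF κ q`. -/
noncomputable def waveV (κ q : ℝ) : ℝ := -(κ * (2 * q ^ 2 + 4 * κ * q + 2)) / waveDen κ q ^ 2

theorem hasDerivAt_waveF {κ q : ℝ} (hκ : 0 < κ) (hq : 0 ≤ q) : HasDerivAt (waveF κ)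
    (-(2 * κ) / waveDen κ q + (2 + 2 * κ * q) ^ 2 / waveDen κ q ^ 2) q := by
  have h := waveDen_pos hκ hq
  have h1 : HasDerivAt (fun q => -(2 + 2 * κ * q)) (-(2 * κ)) q := by
    refine (((hasDerivAt_id q).const_mul (2 * κ)).const_add 2).neg.congr_deriv ?_
    simp
  refine (h1.div (hasDerivAt_waveDen κ q) h.ne').congr_deriv ?_
  field_simp
  ring

theorem hasDerivAt_mul_waveF {κ q : ℝ} (hκ : 0 < κ) (hq : 0 ≤ q) :
    HasDerivAt (fun q => q * waveF κ q) (waveV κ q) q := by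
  have h := waveDen_pos hκ hq
  refine ((hasDerivAt_id q).mul (hasDerivAt_waveF hκ hq)).congr_deriv ?_
  simp only [waveF, waveV, id, one_mul]
  field_simp
  unfold waveDen
  ring

theorem hasDerivAt_waveV {κ q : ℝ} (hκ : 0 < κ) (hq : 0 ≤ q) : HasDerivAt (waveV κ)
    (-(κ * (4 * q + 4 * κ)) / waveDen κ q ^ 2 +
      2 * (κ * (2 * q ^ 2 + 4 * κ * q + 2)) * (2 + 2 * κ * q) / waveDen κ q ^ 3) q := by
  have h := waveDen_pos hκ hq
  have h1 : HasDerivAt (fun q => -(κ * (2 * q ^ 2 + 4 * κ * q + 2))) (-(κ * (4 * q + 4 * κ))) q := by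
    refine ((((((hasDerivAt_pow 2 q).const_mul 2).add
      ((hasDerivAt_id q).const_mul (4 * κ))).add_const 2).const_mul κ).neg).congr_deriv ?_
    push_cast
    ring
  refine (h1.div ((hasDerivAt_waveDen κ q).pow 2) (pow_ne_zero 2 h.ne')).congr_deriv ?_
  simp only [Pi.pow_apply]
  field_simp
  ring

/-- `waveF` as an element of the Banach algebra. -/
noncomputable def waveFI (κ : ℝ) (hκ : 0 < κ) : CI :=
  ⟨fun q => waveF κ q, continuous_iff_continuousAt.2 fun q =>
    (hasDerivAt_waveF hκ q.2.1).continuousAt.comp continuous_subtype_val.continuousAt⟩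

/-- `waveV` as an element of the Banach algebra. -/
noncomputable def waveVI (κ : ℝ) (hκ : 0 < κ) : CI :=
  ⟨fun q => waveV κ q, continuous_iff_continuousAt.2 fun q =>
    (hasDerivAt_waveV hκ q.2.1).continuousAt.comp continuous_subtype_val.continuousAt⟩

theorem waveFI_apply (κ : ℝ) (hκ : 0 < κ) (q : Icc (0 : ℝ) 2) : waveFI κ hκ q = waveF κ q := rfl
theorem waveVI_apply (κ : ℝ) (hκ : 0 < κ) (q : Icc (0 : ℝ) 2) : waveVI κ hκ q = waveV κ q := rfl

theorem prim_waveVI (κ : ℝ) (hκ : 0 < κ) (q : Icc (0 : ℝ) 2) :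
    CI.prim (waveVI κ hκ) q = q * waveF κ q := by
  rw [CI.prim_eq_of_hasDerivAt _ (fun x => hasDerivAt_mul_waveF hκ x.2.1)]
  simp

theorem amp_waveFI (ω κ : ℝ) (hκ : 0 < κ) (q : Icc (0 : ℝ) 2) :
    amp (waveFI κ hκ) (8 * ω / κ) q = 8 * ω / waveDen κ q := by
  have h0 := waveDen_pos hκ q.2.1
  have h1 : waveDen κ 0 = κ := by simp [waveDen]
  have h : ∀ x : Icc (0 : ℝ) 2,
      HasDerivAt (fun x => -Real.log (waveDen κ x)) (waveFI κ hκ x) x := by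
    intro x
    refine ((hasDerivAt_waveDen κ x).log (waveDen_pos hκ x.2.1).ne').neg.congr_deriv ?_
    rw [waveFI_apply, waveF]
    ring
  rw [amp_apply, CI.prim_eq_of_hasDerivAt _ h, h1, sub_neg_eq_add, Real.exp_add, Real.exp_neg,
    Real.exp_log h0, Real.exp_log hκ]
  field_simp

theorem profileEq_wave (ω κ : ℝ) (hω : 0 < ω) (hκ : 0 < κ) :
    profileEq (baseParam (1 / ω) (3 * (κ ^ 2 - 1) / (16 * ω ^ 2)), waveFI κ hκ, 0, 8 * ω / κ) = 0 := by
  have h1 : CI.avg 1 (profileRe (baseParam (1 / ω) (3 * (κ ^ 2 - 1) / (16 * ω ^ 2))) (waveFI κ hκ) 0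
      (amp (waveFI κ hκ) (8 * ω / κ))) = (-2 : ℝ) • waveFI κ hκ := by
    ext q
    rw [CI.avg_eq_of_hasDerivAt 1 _ (g := fun x => -2 * waveF κ x)
      (fun x hx => (hasDerivAt_waveF hκ hx.1).const_mul _)]
    · rfl
    · intro x
      have h := waveDen_pos hκ x.2.1
      simp only [profileRe, baseParam, ContinuousMap.add_apply, ContinuousMap.sub_apply,
        ContinuousMap.smul_apply, ContinuousMap.mul_apply, ContinuousMap.pow_apply, amp_waveFI,
        CI.X_apply, waveFI_apply, waveF]
      simp
      field_simp
      unfold waveDen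
      ring
  have h2 : profileIm (baseParam (1 / ω) (3 * (κ ^ 2 - 1) / (16 * ω ^ 2))) (waveFI κ hκ) 0
      (amp (waveFI κ hκ) (8 * ω / κ)) = 0 := by
    ext q
    simp [profileIm, baseParam]
  have h3 : waveF κ 1 = -1 := by
    have : (2 + κ * (1 + 1)) ≠ 0 := by positivity
    simp only [waveF, waveDen]
    field_simp
    ring
  simp only [profileEq, h1, h2, Prod.mk_eq_zero]
  refine ⟨by module, by simp, ?_⟩
  rw [waveFI_apply, show ((onePt : Icc (0 : ℝ) 2) : ℝ) = 1 from rfl, h3]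
  norm_num

theorem waveV_neg {κ q : ℝ} (hκ : 0 < κ) (hq : 0 ≤ q) : waveV κ q < 0 := by
  have h := waveDen_pos hκ hq
  unfold waveV
  exact div_neg_of_neg_of_pos (neg_neg_of_pos (by positivity)) (by positivity)

/-- Translation in z is dilation in q: it sends f(q) to λf(λq) and Y to λY. Its generator at λ = 1
is v = (qf)' with t = Y, which supplies the null direction. That v(1) ≠ 0 is transversality of the
wave to the section s = 0. -/
theorem isInvertible_fderiv_profileEq_wave (ω κ : ℝ) (hω : 0 < ω) (hκ : 0 < κ) :
    (fderiv ℝ profileEq (baseParam (1 / ω) (3 * (κ ^ 2 - 1) / (16 * ω ^ 2)), waveFI κ hκ, 0,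
      8 * ω / κ) ∘L .inr ℝ (Fin 6 → ℝ) (CI × CI × ℝ)).IsInvertible := by
  refine isInvertible_fderiv_profileEq _ _ _ _ (waveVI κ hκ) (by positivity)
    (waveV_neg hκ zero_le_one).ne ?_
  rw [(?_ : CI.avg 1 _ = (-2 : ℝ) • waveVI κ hκ)]
  · module
  · ext q
    rw [CI.avg_eq_of_hasDerivAt 1 _ (g := fun x => -2 * waveV κ x)
      (fun x hx => (hasDerivAt_waveV hκ hx.1).const_mul _)]
    · rfl
    · intro x
      have h := waveDen_pos hκ x.2.1
      simp only [ContinuousMap.add_apply, ContinuousMap.one_apply,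
        ContinuousMap.smul_apply, ContinuousMap.mul_apply, ContinuousMap.pow_apply, amp_waveFI,
        CI.X_apply, waveFI_apply, waveVI_apply, prim_waveVI, waveF, waveV, smul_eq_mul]
      push_cast
      field_simp
      unfold waveDen
      ring

/-! ### From solutions of the profile equation to orbits -/

theorem eq_smul_avg_of_profileEq {l : Fin 6 → ℝ} {f g : CI} {Y : ℝ}
    (h : profileEq (l, f, g, Y) = 0) :
    f = (-1 / 2 : ℝ) • CI.avg 1 (profileRe l f g (amp f Y)) ∧
      g = (-1 / 2 : ℝ) • CI.avg 1 (profileIm l f g (amp f Y)) ∧ f onePt = -1 := by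
  simp only [profileEq, Prod.mk_eq_zero] at h
  obtain ⟨h1, h2, h3⟩ := h
  refine ⟨?_, ?_, by linarith⟩
  · exact (eq_neg_of_add_eq_zero_left h1).trans (by module)
  · exact (eq_neg_of_add_eq_zero_left h2).trans (by module)

theorem hasDerivAt_mul_ext {n f : CI} (h : f = (-1 / 2 : ℝ) • CI.avg 1 n) {q : ℝ}
    (hq : q ∈ Ioo (0 : ℝ) 2) :
    HasDerivAt (fun q => q * f.ext q) (-f.ext q - n.ext q / 2) q := by
  have h1 : ∀ x, f.ext x = -1 / 2 * (CI.avg 1 n).ext x := fun x => by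
    conv_lhs => rw [h]
    rw [CI.ext_smul]
  have h2 := (hasDerivAt_id q).mul ((CI.hasDerivAt_ext_avg 1 n hq).const_mul (-1 / 2))
  have h3 : (fun q => q * f.ext q) = fun q => q * (-1 / 2 * (CI.avg 1 n).ext q) :=
    funext fun q => by rw [h1]
  rw [h3]
  refine h2.congr_deriv ?_
  have := hq.1.ne'
  rw [h1]
  simp only [id]
  push_cast
  field_simp
  ring

theorem hasDerivAt_ext_amp (f : CI) (Y : ℝ) {q : ℝ} (hq : q ∈ Ioo (0 : ℝ) 2) :
    HasDerivAt (amp f Y).ext ((amp f Y).ext q * f.ext q) q := by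
  have h := ((CI.hasDerivAt_ext_prim f hq).exp.const_mul Y)
  have h1 : ∀ x ∈ Ioo (0 : ℝ) 2, (amp f Y).ext x = Y * Real.exp ((CI.prim f).ext x) := by
    intro x hx
    rw [CI.ext_of_mem _ (Ioo_subset_Icc_self hx), CI.ext_of_mem _ (Ioo_subset_Icc_self hx), amp_apply]
  refine (h.congr_of_eventuallyEq ?_).congr_deriv ?_
  · filter_upwards [Ioo_mem_nhds hq.1 hq.2] with x hx using h1 x hx
  · rw [h1 q hq]
    ring

theorem amp_ext_pos (f : CI) {Y : ℝ} (hY : 0 < Y) (q : ℝ) : 0 < (amp f Y).ext q := by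
  have : (amp f Y).ext q = amp f Y (projIcc (0 : ℝ) 2 (by norm_num) q) := rfl
  rw [this, amp_apply]
  positivity

/-- The derivative of `q ↦ q f(q)` for a solution of the profile equation. -/
noncomputable def profileSlope (l : Fin 6 → ℝ) (f g : CI) (Y : ℝ) : CI :=
  -f - (1 / 2 : ℝ) • profileRe l f g (amp f Y)

theorem profileSlope_ext (l : Fin 6 → ℝ) (f g : CI) (Y q : ℝ) :
    (profileSlope l f g Y).ext q = -f.ext q - (profileRe l f g (amp f Y)).ext q / 2 := by
  rw [profileSlope, CI.ext_sub, CI.ext_smul]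
  change -f.ext q - _ = _
  ring

/-- A negative slope makes 1 + qf strictly decreasing, and it vanishes at q = 1. This is what makes
that crossing of the section the first one. -/
theorem one_add_mul_ext_pos {l : Fin 6 → ℝ} {f g : CI} {Y : ℝ}
    (h : profileEq (l, f, g, Y) = 0) (hs : ∀ q, profileSlope l f g Y q < 0) {q : ℝ}
    (hq0 : 0 < q) (hq1 : q < 1) : 0 < 1 + q * f.ext q := by
  obtain ⟨h1, -, h3⟩ := eq_smul_avg_of_profileEq h
  have hd : ∀ x ∈ Ioo (0 : ℝ) 2,
      HasDerivAt (fun q => q * f.ext q) ((profileSlope l f g Y).ext x) x := fun x hx => by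
    rw [profileSlope_ext]
    exact hasDerivAt_mul_ext h1 hx
  have hanti : StrictAntiOn (fun q => q * f.ext q) (Ioo (0 : ℝ) 2) := by
    refine strictAntiOn_of_deriv_neg (convex_Ioo _ _)
      (fun x hx => (hd x hx).continuousAt.continuousWithinAt) fun x hx => ?_
    rw [interior_Ioo] at hx
    rw [(hd x hx).deriv, CI.ext_of_mem _ (Ioo_subset_Icc_self hx)]
    exact hs _
  have h4 := hanti (a := q) (b := 1) ⟨hq0, by linarith⟩ ⟨one_pos, one_lt_two⟩ hq1
  have h5 : f.ext 1 = -1 := by rw [← h3]; exact CI.ext_of_mem f onePt.2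
  simp only [h5] at h4
  linarith

/-- The orbit `(r, s, φ)` built from a solution of the profile equation. -/
noncomputable def profileOrbit (σ ψ k : ℝ) (f g : CI) (Y z : ℝ) : ℝ × ℝ × ℝ :=
  (√(Real.exp (2 * σ * z) * (amp f Y).ext (Real.exp (2 * σ * z))),
    σ * (1 + Real.exp (2 * σ * z) * f.ext (Real.exp (2 * σ * z))),
    ψ - k + σ * (Real.exp (2 * σ * z) * g.ext (Real.exp (2 * σ * z))))

/-- `(l, f, g, Y)` solves the profile equation attached to the steady-state equation with
parameters `P` and speed `c = 2 Δ k`; `S + iψ` is the rest state of the equation in which the square has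
been completed, and `σ` the growth rate. -/
structure IsProfile (P : PCQParams) (k σ S ψ : ℝ) (l : Fin 6 → ℝ) (f g : CI) (Y : ℝ) : Prop where
  growth_pos : 0 < σ
  growth : σ = S - k * P.ε * P.a
  rest_re : P.ω - P.ε ^ 2 * P.a * P.b = P.Δ * (S ^ 2 - ψ ^ 2 + k ^ 2 * (1 - P.ε ^ 2 * P.a ^ 2))
  rest_im : P.ε * (P.b + P.a * P.ω) = P.Δ * (-2 * S * ψ + 2 * k ^ 2 * P.ε * P.a)
  l0 : σ * l 0 = S - σ
  l1 : σ * l 1 = ψ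
  l2 : P.Δ * (σ ^ 2 * l 2) = 1 + P.ε ^ 2 * P.a * P.d₁
  l3 : P.Δ * (σ ^ 2 * l 3) = P.ε * (P.d₁ - P.a)
  l4 : P.Δ * (σ ^ 2 * l 4) = P.α + P.ε ^ 2 * P.a * P.d₂
  l5 : P.Δ * (σ ^ 2 * l 5) = P.ε * (P.d₂ - P.a * P.α)
  eq : profileEq (l, f, g, Y) = 0
  pos : 0 < Y
  slope : ∀ q, profileSlope l f g Y q < 0

theorem PCQParams.Δ_pos (P : PCQParams) : 0 < P.Δ := by
  unfold PCQParams.Δ; positivity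

section
variable {P : PCQParams} {k σ S ψ : ℝ} {l : Fin 6 → ℝ} {f g : CI} {Y : ℝ}

theorem IsProfile.hasDerivAt (h : IsProfile P k σ S ψ l f g Y) {z : ℝ}
    (hz : Real.exp (2 * σ * z) < 2) :
    HasDerivAt (profileOrbit σ ψ k f g Y)
      (P.field (2 * P.Δ * k) (profileOrbit σ ψ k f g Y z)) z := by
  obtain ⟨hf, hg, -⟩ := eq_smul_avg_of_profileEq h.eq
  set q := Real.exp (2 * σ * z) with hq
  have hqm : q ∈ Ioo (0 : ℝ) 2 := ⟨Real.exp_pos _, hz⟩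
  have hqd : HasDerivAt (fun z => Real.exp (2 * σ * z)) (2 * σ * q) z := by
    refine ((hasDerivAt_id z).const_mul (2 * σ)).exp.congr_deriv ?_
    simp only [id, mul_one]
    rw [← hq]
    ring
  set y := amp f Y with hy
  set x := q * y.ext q with hx
  set h₁ := q * f.ext q with hh₁
  set h₂ := q * g.ext q with hh₂
  have hxpos : 0 < x := mul_pos hqm.1 (amp_ext_pos f h.pos q)
  have dx : HasDerivAt (fun z => Real.exp (2 * σ * z) * y.ext (Real.exp (2 * σ * z)))
      (2 * σ * x * (1 + h₁)) z := by
    have h1 : HasDerivAt (fun q => q * y.ext q) (1 * y.ext q + q * (y.ext q * f.ext q)) q :=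
      (hasDerivAt_id q).mul (hasDerivAt_ext_amp f Y hqm)
    refine (HasDerivAt.comp z (h₂ := fun q => q * y.ext q) h1 hqd).congr_deriv ?_
    simp only [hx, hh₁]
    ring
  have dh₁ : HasDerivAt (fun z => Real.exp (2 * σ * z) * f.ext (Real.exp (2 * σ * z)))
      (-2 * σ * h₁ - σ * (h₁ ^ 2 - h₂ ^ 2 + l 2 * x + l 4 * x ^ 2 + 2 * l 0 * h₁ - 2 * l 1 * h₂)) z := by
    refine (HasDerivAt.comp z (h₂ := fun q => q * f.ext q) (hasDerivAt_mul_ext hf hqm) hqd).congr_deriv ?_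
    simp only [profileRe, CI.ext_add, CI.ext_sub, CI.ext_mul, CI.ext_smul, CI.ext_pow,
      ← hq, CI.ext_X (Ioo_subset_Icc_self hqm), hx, hh₁, hh₂]
    ring
  have dh₂ : HasDerivAt (fun z => Real.exp (2 * σ * z) * g.ext (Real.exp (2 * σ * z)))
      (-2 * σ * h₂ - σ * (2 * h₁ * h₂ + l 3 * x + l 5 * x ^ 2 + 2 * l 0 * h₂ + 2 * l 1 * h₁)) z := by
    refine (HasDerivAt.comp z (h₂ := fun q => q * g.ext q) (hasDerivAt_mul_ext hg hqm) hqd).congr_deriv ?_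
    simp only [profileIm, CI.ext_add, CI.ext_mul, CI.ext_smul, CI.ext_pow,
      ← hq, CI.ext_X (Ioo_subset_Icc_self hqm), hx, hh₁, hh₂]
    ring
  have hΔ := P.Δ_pos.ne'
  have hr : (√x) ^ 2 = x := Real.sq_sqrt hxpos.le
  have hr4 : (√x) ^ 4 = x ^ 2 := by rw [show (4 : ℕ) = 2 * 2 by norm_num, pow_mul, hr]
  have dr := dx.sqrt hxpos.ne'
  have ds := ((dh₁.const_add 1).const_mul σ)
  have dφ := ((dh₂.const_mul σ).const_add (ψ - k))
  refine (dr.prodMk (ds.prodMk dφ)).congr_deriv ?_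
  have hS : S = σ + k * P.ε * P.a := by rw [h.growth]; ring
  refine Prod.ext ?_ (Prod.ext ?_ ?_)
  · simp only [PCQParams.field, profileOrbit, ← hq, ← hy, ← hx, ← hh₁]
    have : √x ≠ 0 := (Real.sqrt_pos.2 hxpos).ne'
    rw [div_eq_iff (by positivity)]
    linear_combination (-2 * σ * (1 + h₁)) * hr
  · simp only [PCQParams.field, profileOrbit, ← hq, ← hy, ← hx, ← hh₁, ← hh₂, hr, hr4]
    rw [eq_div_iff hΔ]
    -- Expanding about the rest state, the constant terms cancel by `rest_re`, and the linear ones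
    -- combine through S = σ + kεa into the coefficients `l 0`, `l 1`.
    linear_combination (-2 * P.Δ * σ * h₁) * h.l0 + (2 * P.Δ * σ * h₂) * h.l1 - h.rest_re +
      P.Δ * (-2 * σ * h₁ - (S + σ + k * P.ε * P.a)) * hS - x * h.l2 - x ^ 2 * h.l4
  · simp only [PCQParams.field, profileOrbit, ← hq, ← hy, ← hx, ← hh₁, ← hh₂, hr, hr4]
    rw [eq_div_iff hΔ]
    linear_combination (-2 * P.Δ * σ * h₂) * h.l0 - (2 * P.Δ * σ * h₁) * h.l1 + h.rest_im +
      P.Δ * (-2 * σ * h₂ - 2 * ψ) * hS - x * h.l3 - x ^ 2 * h.l5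

theorem IsProfile.isLeftRest (h : IsProfile P k σ S ψ l f g Y) :
    P.IsLeftRest (2 * P.Δ * k) (0, σ, ψ - k) := by
  refine ⟨rfl, h.growth_pos, ?_⟩
  have hS : S = σ + k * P.ε * P.a := by rw [h.growth]; ring
  simp only [PCQParams.field, zero_mul, Prod.mk_eq_zero, div_eq_zero_iff, true_and]
  constructor
  · left
    linear_combination h.rest_re + P.Δ * (S + σ + k * P.ε * P.a) * hS
  · left
    linear_combination -h.rest_im + P.Δ * (2 * ψ) * hS

theorem IsProfile.tendsto (h : IsProfile P k σ S ψ l f g Y) :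
    Tendsto (profileOrbit σ ψ k f g Y) atBot (𝓝 (0, σ, ψ - k)) := by
  have hq : Tendsto (fun z => Real.exp (2 * σ * z)) atBot (𝓝 0) :=
    Real.tendsto_exp_atBot.comp (tendsto_id.const_mul_atBot (by have := h.growth_pos; positivity))
  have hm : ∀ n : CI, Tendsto (fun z => Real.exp (2 * σ * z) * n.ext (Real.exp (2 * σ * z)))
      atBot (𝓝 0) := fun n => by
    simpa using hq.mul ((n.continuous_ext.tendsto 0).comp hq)
  refine Tendsto.prodMk_nhds ?_ (Tendsto.prodMk_nhds ?_ ?_)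
  · simpa using (hm (amp f Y)).sqrt
  · simpa using ((hm f).const_add 1).const_mul σ
  · simpa using ((hm g).const_mul σ).const_add (ψ - k)

theorem IsProfile.isUnstableOrbit (h : IsProfile P k σ S ψ l f g Y) {η : ℝ}
    (hη : Real.exp (2 * σ * η) ≤ 2) :
    P.IsUnstableOrbit (2 * P.Δ * k) η (profileOrbit σ ψ k f g Y) := by
  refine ⟨fun z hz => h.hasDerivAt ?_, fun z _ => ?_, _, h.isLeftRest, h.tendsto⟩
  · refine lt_of_lt_of_le (Real.exp_lt_exp.2 ?_) hη
    have := h.growth_pos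
    gcongr
  · exact Real.sqrt_pos.2 (mul_pos (Real.exp_pos _) (amp_ext_pos f h.pos _))

theorem IsProfile.firstCrossing (h : IsProfile P k σ S ψ l f g Y) {η : ℝ} (hη : 0 < η) :
    FirstCrossing η (profileOrbit σ ψ k f g Y) 0 := by
  refine ⟨hη, ?_, fun z hz => ?_⟩
  · have h5 : f.ext 1 = -1 := by
      rw [← (eq_smul_avg_of_profileEq h.eq).2.2]
      exact CI.ext_of_mem f onePt.2
    simp [profileOrbit, h5]
  · refine mul_pos h.growth_pos (one_add_mul_ext_pos h.eq h.slope (Real.exp_pos _) ?_)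
    rw [Real.exp_lt_one_iff]
    have := h.growth_pos
    exact mul_neg_of_pos_of_neg (by positivity) hz

theorem profileOrbit_zero_fst (σ ψ k : ℝ) (f g : CI) (Y : ℝ) :
    (profileOrbit σ ψ k f g Y 0).1 = √(amp f Y onePt) := by
  simp only [profileOrbit, mul_zero, Real.exp_zero, one_mul]
  congr 1
  exact CI.ext_of_mem _ onePt.2

/-- The explicit constant matters only in that it is independent of c: it makes the later error in
the phase shift uniform in c. -/
theorem norm_profileOrbit_le {σ ψ k C : ℝ} {f g : CI} {Y : ℝ} (hf : ‖f‖ ≤ C) (hg : ‖g‖ ≤ C)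
    (hy : ‖amp f Y‖ ≤ C) (hσ : |σ| ≤ C) (hψ : |ψ| ≤ C) (hk : |k| ≤ C) {z : ℝ}
    (hz : Real.exp (2 * σ * z) ≤ 2) :
    ‖profileOrbit σ ψ k f g Y z‖ ≤ (2 * C + 1) ^ 2 := by
  have hC : 0 ≤ C := (abs_nonneg _).trans hσ
  have hm : ∀ n : CI, ‖n‖ ≤ C → |Real.exp (2 * σ * z) * n.ext (Real.exp (2 * σ * z))| ≤ 2 * C := by
    intro n hn
    rw [abs_mul, Real.abs_exp]
    exact mul_le_mul hz ((n.abs_ext_le _).trans hn) (abs_nonneg _) zero_le_two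
  simp only [profileOrbit, Prod.norm_def, Real.norm_eq_abs, sup_le_iff]
  refine ⟨?_, ?_, ?_⟩
  · rw [abs_of_nonneg (Real.sqrt_nonneg _), Real.sqrt_le_left (by positivity)]
    have := (le_abs_self _).trans (hm _ hy)
    nlinarith [mul_nonneg hC hC, mul_nonneg (mul_nonneg hC hC) hC, mul_nonneg (mul_nonneg hC hC) (mul_nonneg hC hC)]
  · rw [abs_mul]
    have h1 : |1 + Real.exp (2 * σ * z) * f.ext (Real.exp (2 * σ * z))| ≤ 1 + 2 * C :=
      (abs_add_le _ _).trans (by rw [abs_one]; linarith [hm f hf])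
    calc _ ≤ C * (1 + 2 * C) := mul_le_mul hσ h1 (abs_nonneg _) hC
      _ ≤ _ := by nlinarith
  · have h1 := mul_le_mul hσ (hm g hg) (abs_nonneg _) hC
    rw [← abs_mul] at h1
    have h2 := abs_add_le (ψ - k) (σ * (Real.exp (2 * σ * z) * g.ext (Real.exp (2 * σ * z))))
    have h3 := abs_sub ψ k
    nlinarith

end

/-! ### Uniqueness of the unstable orbit and the effect of its phase -/

theorem PCQParams.contDiff_field (P : PCQParams) (c : ℝ) {n : WithTop ℕ∞} :
    ContDiff ℝ n (P.field c) := by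
  unfold PCQParams.field
  fun_prop

/-- Two solutions of an autonomous `C¹` equation which agree at one time agree. -/
theorem eqOn_Iio_of_hasDerivAt {F : ℝ × ℝ × ℝ → ℝ × ℝ × ℝ} (hF : ContDiff ℝ 1 F)
    {u v : ℝ → ℝ × ℝ × ℝ} {η t₀ : ℝ} (hu : ∀ z < η, HasDerivAt u (F (u z)) z)
    (hv : ∀ z < η, HasDerivAt v (F (v z)) z) (ht : t₀ < η) (h : u t₀ = v t₀) :
    ∀ z < η, u z = v z := by
  intro z hz
  set a := min t₀ z - 1 with ha
  obtain ⟨b, hb1, hb2⟩ := exists_between (max_lt ht hz)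
  have hsub : Icc a b ⊆ Iio η := fun x hx => lt_of_le_of_lt hx.2 hb2
  have hcu : ContinuousOn u (Icc a b) := fun x hx => (hu x (hsub hx)).continuousAt.continuousWithinAt
  have hcv : ContinuousOn v (Icc a b) := fun x hx => (hv x (hsub hx)).continuousAt.continuousWithinAt
  obtain ⟨A, hA⟩ := isCompact_Icc.exists_bound_of_continuousOn hcu
  obtain ⟨B, hB⟩ := isCompact_Icc.exists_bound_of_continuousOn hcv
  obtain ⟨K, hK⟩ := (hF.contDiffOn (s := Metric.closedBall 0 (max A B))).exists_lipschitzOnWith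
    one_ne_zero (convex_closedBall _ _) (isCompact_closedBall _ _)
  have h1 := min_le_left t₀ z
  have h2 := min_le_right t₀ z
  have h3 := le_max_left t₀ z
  have h4 := le_max_right t₀ z
  refine ODE_solution_unique_of_mem_Ioo (v := fun _ => F) (s := fun _ => Metric.closedBall 0 (max A B))
    (a := a) (b := b) (t₀ := t₀) (fun _ _ => hK) ⟨by linarith, by linarith⟩
    (fun t ht => ⟨hu t (hsub (Ioo_subset_Icc_self ht)), ?_⟩)
    (fun t ht => ⟨hv t (hsub (Ioo_subset_Icc_self ht)), ?_⟩) h ⟨by linarith, by linarith⟩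
  · exact mem_closedBall_zero_iff.2 ((hA t (Ioo_subset_Icc_self ht)).trans (le_max_left _ _))
  · exact mem_closedBall_zero_iff.2 ((hB t (Ioo_subset_Icc_self ht)).trans (le_max_right _ _))

/-- An increasing function with positive derivative that comes from `-∞` has a differentiable
inverse near `-∞`. -/
theorem exists_inverse_near_atBot {ρ ρ' : ℝ → ℝ} {z₀ : ℝ}
    (hd : ∀ z ≤ z₀, HasDerivAt ρ (ρ' z) z) (hpos : ∀ z ≤ z₀, 0 < ρ' z)
    (hlim : Tendsto ρ atBot atBot) :
    ∃ ζ : ℝ → ℝ, Tendsto ζ atBot atBot ∧ ∀ x < ρ z₀, ζ x < z₀ ∧ ρ (ζ x) = x ∧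
      HasDerivAt ζ (ρ' (ζ x))⁻¹ x := by
  have hcont : ContinuousOn ρ (Iic z₀) := fun z hz => (hd z hz).continuousAt.continuousWithinAt
  have hmono : StrictMonoOn ρ (Iic z₀) := by
    refine strictMonoOn_of_deriv_pos (convex_Iic _) hcont fun z hz => ?_
    rw [interior_Iic] at hz
    rw [(hd z (le_of_lt hz)).deriv]
    exact hpos z (le_of_lt hz)
  have hex : ∀ x < ρ z₀, ∃ z < z₀, ρ z = x := by
    intro x hx
    obtain ⟨z₁, hz₁, hz₁'⟩ := ((hlim.eventually_lt_atBot x).and (eventually_lt_atBot z₀)).exists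
    obtain ⟨z, hz, rfl⟩ := intermediate_value_Icc hz₁'.le
      (hcont.mono Icc_subset_Iic_self) ⟨hz₁.le, hx.le⟩
    exact ⟨z, lt_of_le_of_ne hz.2 (by rintro rfl; exact lt_irrefl _ hx), rfl⟩
  choose! ζ hζ hζ' using hex
  have hle : ∀ x < ρ z₀, ∀ z ≤ z₀, x ≤ ρ z → ζ x ≤ z := fun x hx z hz hxz => by
    rw [← hmono.le_iff_le (hζ x hx).le hz, hζ' x hx]
    exact hxz
  have hmonoζ : StrictMonoOn ζ (Iio (ρ z₀)) := fun x hx y hy hxy => by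
    rw [← hmono.lt_iff_lt (hζ x hx).le (hζ y hy).le, hζ' x hx, hζ' y hy]
    exact hxy
  have himg : ζ '' Iio (ρ z₀) = Iio z₀ := by
    ext z
    constructor
    · rintro ⟨x, hx, rfl⟩
      exact hζ x hx
    · intro hz
      have h1 : ρ z < ρ z₀ := hmono (mem_Iic.2 (le_of_lt hz)) (mem_Iic.2 le_rfl) hz
      exact ⟨ρ z, h1, hmono.injOn (mem_Iic.2 (hζ _ h1).le) (mem_Iic.2 (le_of_lt hz)) (hζ' _ h1)⟩
  refine ⟨ζ, ?_, fun x hx => ⟨hζ x hx, hζ' x hx, ?_⟩⟩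
  · rw [tendsto_atBot]
    intro b
    filter_upwards [eventually_lt_atBot (ρ z₀), eventually_le_atBot (ρ (min b z₀))] with x hx hx'
    exact (hle x hx _ (min_le_right _ _) hx').trans (min_le_left _ _)
  · have hc : ContinuousAt ζ x := hmonoζ.continuousAt_of_image_mem_nhds (Iio_mem_nhds hx)
      (by rw [himg]; exact Iio_mem_nhds (hζ x hx))
    refine HasDerivAt.of_local_left_inverse hc (hd _ (hζ x hx).le) (hpos _ (hζ x hx).le).ne' ?_
    filter_upwards [Iio_mem_nhds hx] with y hy using hζ' y hy

/-- A nonnegative bounded function that contracts at a uniform rate from `-∞` vanishes. -/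
theorem eq_zero_of_deriv_le_neg_mul {E E' : ℝ → ℝ} {L κ B : ℝ} (hκ : 0 < κ)
    (hd : ∀ x < L, HasDerivAt E (E' x) x) (hle : ∀ x < L, E' x ≤ -κ * E x)
    (hE : ∀ x < L, 0 ≤ E x) (hB : ∀ x < L, E x ≤ B) : ∀ x < L, E x = 0 := by
  have hd' : ∀ x < L, HasDerivAt (fun x => Real.exp (κ * x) * E x)
      (Real.exp (κ * x) * κ * E x + Real.exp (κ * x) * E' x) x := fun x hx => by
    have h1 : HasDerivAt (fun x => Real.exp (κ * x)) (Real.exp (κ * x) * κ) x := by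
      simpa using ((hasDerivAt_id x).const_mul κ).exp
    exact h1.mul (hd x hx)
  -- The weighted function exp(κx)E decreases, yet it tends to 0 at -∞ because E is bounded; being
  -- nonnegative, it is zero.
  have hanti : AntitoneOn (fun x => Real.exp (κ * x) * E x) (Iio L) := by
    refine antitoneOn_of_deriv_nonpos (convex_Iio _)
      (fun x hx => (hd' x hx).continuousAt.continuousWithinAt)
      (fun x hx => ?_) fun x hx => ?_
    · rw [interior_Iio] at hx
      exact (hd' x hx).differentiableAt.differentiableWithinAt
    · rw [interior_Iio] at hx
      rw [(hd' x hx).deriv]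
      have := mul_le_mul_of_nonneg_left (hle x hx) (Real.exp_pos (κ * x)).le
      linarith
  intro x hx
  have hlim : Tendsto (fun y => Real.exp (κ * y) * B) atBot (𝓝 0) := by
    simpa using (Real.tendsto_exp_atBot.comp (tendsto_id.const_mul_atBot hκ)).mul_const B
  have h1 : Real.exp (κ * x) * E x ≤ 0 := by
    refine ge_of_tendsto hlim ?_
    filter_upwards [eventually_le_atBot x] with y hy
    have hyL := lt_of_le_of_lt hy hx
    exact (hanti hyL hx hy).trans (mul_le_mul_of_nonneg_left (hB y hyL) (Real.exp_pos _).le)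
  refine le_antisymm ?_ (hE x hx)
  by_contra hlt
  exact absurd h1 (not_le.2 (mul_pos (Real.exp_pos _) (not_le.1 hlt)))

/-- An orbit reparametrized by the logarithm of its first component. -/
theorem PCQParams.exists_reparam (P : PCQParams) {c η : ℝ} {u : ℝ → ℝ × ℝ × ℝ} {p : ℝ × ℝ × ℝ}
    (hd : ∀ z < η, HasDerivAt u (P.field c (u z)) z) (hr : ∀ z < η, 0 < (u z).1)
    (hp1 : p.1 = 0) (hp : 0 < p.2.1) (hlim : Tendsto u atBot (𝓝 p)) :
    ∃ (L : ℝ) (ζ : ℝ → ℝ), Tendsto (fun x => u (ζ x)) atBot (𝓝 p) ∧ ∀ x < L, ζ x < η ∧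
      (u (ζ x)).1 = Real.exp x ∧
      HasDerivAt (fun x => u (ζ x)) ((u (ζ x)).2.1⁻¹ • P.field c (u (ζ x))) x := by
  have hs : Tendsto (fun z => (u z).2.1) atBot (𝓝 p.2.1) :=
    (continuous_fst.comp continuous_snd).continuousAt.tendsto.comp hlim
  obtain ⟨z₀, hz₀⟩ := eventually_atBot.1 ((hs.eventually_const_lt hp).and (eventually_lt_atBot η))
  have hrd : ∀ z ≤ z₀, HasDerivAt (fun z => Real.log (u z).1) ((u z).2.1) z := by
    intro z hz
    have hzη := (hz₀ z hz).2
    have h1 : HasDerivAt (fun z => (u z).1) ((u z).1 * (u z).2.1) z := (hd z hzη).fst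
    refine (h1.log (hr z hzη).ne').congr_deriv ?_
    have := (hr z hzη).ne'
    field_simp
  have hrlim : Tendsto (fun z => Real.log (u z).1) atBot atBot := by
    refine Real.tendsto_log_nhdsGT_zero.comp (tendsto_nhdsWithin_iff.2 ⟨?_, ?_⟩)
    · have := (continuous_fst (X := ℝ) (Y := ℝ × ℝ)).continuousAt.tendsto.comp hlim
      rwa [hp1] at this
    · filter_upwards [eventually_lt_atBot η] with z hz using hr z hz
  obtain ⟨ζ, hζlim, hζ⟩ := exists_inverse_near_atBot hrd (fun z hz => (hz₀ z hz).1) hrlim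
  refine ⟨Real.log (u z₀).1, ζ, hlim.comp hζlim, fun x hx => ?_⟩
  obtain ⟨h1, h2, h3⟩ := hζ x hx
  have h4 := (hz₀ _ h1.le).2
  refine ⟨h4, ?_, ?_⟩
  · rw [← Real.exp_log (hr _ h4), h2]
  · exact (hd _ h4).scomp x h3

/-- The terms in N rotate the difference vector and cancel in its squared length. Besides the
damping s₁ + s₂ + G there remains only the effect of the two different time changes 1/s₁ and 1/s₂,
of size (|B| + |C|)/(s₁s₂), which is small near an equilibrium. -/
theorem contraction_inequality {s₁ s₂ b G N B C m : ℝ} (h₁ : 0 < s₁) (h₂ : 0 < s₂)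
    (hq : m / 2 < (s₁ + s₂ + G) / s₂ - (|B| + |C|) / (s₁ * s₂)) :
    2 * (s₂ - s₁) * (s₂⁻¹ * (B - (s₁ + s₂ + G) * (s₂ - s₁) + N * b) - s₁⁻¹ * B) +
        2 * b * (s₂⁻¹ * (C - (s₁ + s₂ + G) * b - N * (s₂ - s₁)) - s₁⁻¹ * C) ≤
      -m * ((s₂ - s₁) ^ 2 + b ^ 2) := by
  have hid : 2 * (s₂ - s₁) * (s₂⁻¹ * (B - (s₁ + s₂ + G) * (s₂ - s₁) + N * b) - s₁⁻¹ * B) +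
      2 * b * (s₂⁻¹ * (C - (s₁ + s₂ + G) * b - N * (s₂ - s₁)) - s₁⁻¹ * C) =
      -2 * ((s₁ + s₂ + G) / s₂ * ((s₂ - s₁) ^ 2 + b ^ 2)) -
        2 / (s₁ * s₂) * ((s₂ - s₁) ^ 2 * B + (s₂ - s₁) * b * C) := by
    field_simp
    ring
  rw [hid]
  generalize s₂ - s₁ = a
  have hbd : -(a ^ 2 * B + a * b * C) ≤ (|B| + |C|) * (a ^ 2 + b ^ 2) := by
    have h1 : -(a ^ 2 * B) ≤ |B| * a ^ 2 := by nlinarith [neg_abs_le B, sq_nonneg a]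
    have h2 : -(a * b * C) ≤ |C| * (a ^ 2 + b ^ 2) := by
      have h3 : |a * b| ≤ a ^ 2 + b ^ 2 := by
        rw [abs_le]; constructor <;> nlinarith [sq_nonneg (a + b), sq_nonneg (a - b)]
      calc -(a * b * C) ≤ |a * b * C| := neg_le_abs _
        _ = |C| * |a * b| := by rw [abs_mul]; ring
        _ ≤ _ := mul_le_mul_of_nonneg_left h3 (abs_nonneg _)
    nlinarith [mul_nonneg (abs_nonneg B) (sq_nonneg b)]
  have h1 : 2 / (s₁ * s₂) * -(a ^ 2 * B + a * b * C) ≤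
      2 / (s₁ * s₂) * ((|B| + |C|) * (a ^ 2 + b ^ 2)) :=
    mul_le_mul_of_nonneg_left hbd (by positivity)
  have h2 := mul_le_mul_of_nonneg_right hq.le (by positivity : 0 ≤ a ^ 2 + b ^ 2)
  have h3 : 2 / (s₁ * s₂) * ((|B| + |C|) * (a ^ 2 + b ^ 2)) =
    2 * ((|B| + |C|) / (s₁ * s₂) * (a ^ 2 + b ^ 2)) := by ring
  rw [h3] at h1
  linarith

/-- Near the rest state (log r)' = s > 0, so both orbits can be parametrized by log r and compared
at equal r. Terms in r then drop out of the difference of the fields, and the squared distance in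
(s, φ) contracts at a uniform rate from -∞ while staying bounded; hence it vanishes. -/
theorem PCQParams.exists_eq_of_tendsto (P : PCQParams) {c η₁ η₂ : ℝ} {u v : ℝ → ℝ × ℝ × ℝ}
    {p : ℝ × ℝ × ℝ}
    (hu : ∀ z < η₁, HasDerivAt u (P.field c (u z)) z) (hur : ∀ z < η₁, 0 < (u z).1)
    (hv : ∀ z < η₂, HasDerivAt v (P.field c (v z)) z) (hvr : ∀ z < η₂, 0 < (v z).1)
    (hp : P.IsLeftRest c p) (hγ : 0 < 2 * p.2.1 + c * P.ε * P.a / P.Δ)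
    (hul : Tendsto u atBot (𝓝 p)) (hvl : Tendsto v atBot (𝓝 p)) :
    ∃ z₁ < η₁, ∃ z₂ < η₂, u z₁ = v z₂ := by
  obtain ⟨hp1, hps, hpF⟩ := hp
  obtain ⟨L₁, ζ₁, hl₁, h₁⟩ := P.exists_reparam hu hur hp1 hps hul
  obtain ⟨L₂, ζ₂, hl₂, h₂⟩ := P.exists_reparam hv hvr hp1 hps hvl
  set U := fun x => u (ζ₁ x) with hU
  set V := fun x => v (ζ₂ x) with hV
  have hF : Tendsto (fun x => P.field c (U x)) atBot (𝓝 0) := by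
    rw [← hpF]
    exact ((P.contDiff_field c (n := 1)).continuous.tendsto p).comp hl₁
  have hcs : Continuous fun x : ℝ × ℝ × ℝ => x.2.1 := by fun_prop
  have hcφ : Continuous fun x : ℝ × ℝ × ℝ => x.2.2 := by fun_prop
  have hs₁ : Tendsto (fun x => (U x).2.1) atBot (𝓝 p.2.1) := (hcs.tendsto p).comp hl₁
  have hs₂ : Tendsto (fun x => (V x).2.1) atBot (𝓝 p.2.1) := (hcs.tendsto p).comp hl₂
  have hφ₁ : Tendsto (fun x => (U x).2.2) atBot (𝓝 p.2.2) := (hcφ.tendsto p).comp hl₁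
  have hφ₂ : Tendsto (fun x => (V x).2.2) atBot (𝓝 p.2.2) := (hcφ.tendsto p).comp hl₂
  have hB₁ : Tendsto (fun x => |(P.field c (U x)).2.1|) atBot (𝓝 0) := by
    simpa using ((hcs.tendsto 0).comp hF).abs
  have hB₂ : Tendsto (fun x => |(P.field c (U x)).2.2|) atBot (𝓝 0) := by
    simpa using ((hcφ.tendsto 0).comp hF).abs
  set G : ℝ := c * P.ε * P.a / P.Δ with hG
  set m : ℝ := (2 * p.2.1 + G) / p.2.1 with hm
  have hmpos : 0 < m := div_pos hγ hps
  have hrate : Tendsto (fun x => ((U x).2.1 + (V x).2.1 + G) / (V x).2.1 -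
      (|(P.field c (U x)).2.1| + |(P.field c (U x)).2.2|) / ((U x).2.1 * (V x).2.1)) atBot (𝓝 m) := by
    have := (((hs₁.add hs₂).add_const G).div hs₂ hps.ne').sub
      ((hB₁.add hB₂).div (hs₁.mul hs₂) (mul_pos hps hps).ne')
    rw [show m = (p.2.1 + p.2.1 + G) / p.2.1 - (0 + 0) / (p.2.1 * p.2.1) by rw [hm]; simp; ring]
    exact this
  have hEl : Tendsto (fun x => ((V x).2.1 - (U x).2.1) ^ 2 + ((V x).2.2 - (U x).2.2) ^ 2) atBot (𝓝 0) := by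
    have := ((hs₂.sub hs₁).pow 2).add ((hφ₂.sub hφ₁).pow 2)
    simpa using this
  obtain ⟨L, hL⟩ := eventually_atBot.1 ((((((hrate.eventually_const_lt (half_lt_self hmpos)).and
    (hs₁.eventually_const_lt hps)).and (hs₂.eventually_const_lt hps)).and
    (eventually_lt_atBot L₁)).and (eventually_lt_atBot L₂)).and (hEl.eventually_le_const zero_lt_one))
  have hΔ := P.Δ_pos.ne'
  have key := eq_zero_of_deriv_le_neg_mul (L := L) (B := 1) hmpos
    (E := fun x => ((V x).2.1 - (U x).2.1) ^ 2 + ((V x).2.2 - (U x).2.2) ^ 2)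
    (E' := fun x => 2 * ((V x).2.1 - (U x).2.1) *
        ((V x).2.1⁻¹ * (P.field c (V x)).2.1 - (U x).2.1⁻¹ * (P.field c (U x)).2.1) +
      2 * ((V x).2.2 - (U x).2.2) *
        ((V x).2.1⁻¹ * (P.field c (V x)).2.2 - (U x).2.1⁻¹ * (P.field c (U x)).2.2))
    (fun x hx => ?_) (fun x hx => ?_) (fun x hx => by positivity) (fun x hx => (hL x hx.le).2)
  · obtain ⟨⟨⟨-, hx₁⟩, hx₂⟩, -⟩ := hL (L - 1) (by linarith)
    have h0 := key (L - 1) (by linarith)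
    refine ⟨_, (h₁ _ hx₁).1, _, (h₂ _ hx₂).1, ?_⟩
    have e1 : (V (L - 1)).2.1 - (U (L - 1)).2.1 = 0 := by
      by_contra hne
      have := sq_pos_of_ne_zero hne
      nlinarith [sq_nonneg ((V (L - 1)).2.2 - (U (L - 1)).2.2)]
    have e2 : (V (L - 1)).2.2 - (U (L - 1)).2.2 = 0 := by
      rw [e1] at h0
      simpa using h0
    refine Prod.ext ?_ (Prod.ext (by linarith) (by linarith))
    rw [(h₁ _ hx₁).2.1, (h₂ _ hx₂).2.1]
  · obtain ⟨⟨⟨-, hx₁⟩, hx₂⟩, -⟩ := hL x hx.le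
    have hdU := (h₁ x hx₁).2.2
    have hdV := (h₂ x hx₂).2.2
    have d1 : HasDerivAt (fun x => (U x).2.1) ((U x).2.1⁻¹ * (P.field c (U x)).2.1) x := hdU.snd.fst
    have d2 : HasDerivAt (fun x => (V x).2.1) ((V x).2.1⁻¹ * (P.field c (V x)).2.1) x := hdV.snd.fst
    have d3 : HasDerivAt (fun x => (U x).2.2) ((U x).2.1⁻¹ * (P.field c (U x)).2.2) x := hdU.snd.snd
    have d4 : HasDerivAt (fun x => (V x).2.2) ((V x).2.1⁻¹ * (P.field c (V x)).2.2) x := hdV.snd.snd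
    refine (((d2.sub d1).pow 2).add ((d4.sub d3).pow 2)).congr_deriv ?_
    simp
  · obtain ⟨⟨⟨⟨⟨hq, hsu⟩, hsv⟩, hx₁⟩, hx₂⟩, -⟩ := hL x hx.le
    have hr : (U x).1 = (V x).1 := by rw [(h₁ x hx₁).2.1, (h₂ x hx₂).2.1]
    set s₁ := (U x).2.1 with e1
    set s₂ := (V x).2.1 with e2
    set φ₁ := (U x).2.2 with e3
    set φ₂ := (V x).2.2 with e4
    set B := (P.field c (U x)).2.1 with e5
    set C := (P.field c (U x)).2.2 with e6
    have hB : (P.field c (V x)).2.1 = B - (s₁ + s₂ + G) * (s₂ - s₁) +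
        (φ₁ + φ₂ + c / P.Δ) * (φ₂ - φ₁) := by
      rw [e5]
      simp only [PCQParams.field, ← e1, ← e2, ← e3, ← e4, hr, hG]
      field_simp
      ring
    have hC : (P.field c (V x)).2.2 = C - (s₁ + s₂ + G) * (φ₂ - φ₁) -
        (φ₁ + φ₂ + c / P.Δ) * (s₂ - s₁) := by
      rw [e6]
      simp only [PCQParams.field, ← e1, ← e2, ← e3, ← e4, hr, hG]
      field_simp
      ring
    rw [hB, hC]
    exact contraction_inequality hsu hsv hq

section
variable {P : PCQParams} {k σ S ψ : ℝ} {l : Fin 6 → ℝ} {f g : CI} {Y : ℝ}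

/-- With the square completed, rest states are the two complex square roots of (S + iψ)². The root
-(S + iψ) has s = -(S + kεa) < 0 and is excluded. -/
theorem IsProfile.eq_of_isLeftRest (h : IsProfile P k σ S ψ l f g Y)
    (hS : 0 < S + k * P.ε * P.a) {p : ℝ × ℝ × ℝ} (hp : P.IsLeftRest (2 * P.Δ * k) p) :
    p = (0, σ, ψ - k) := by
  obtain ⟨r, s, φ⟩ := p
  obtain ⟨hr, hs, hF⟩ := hp
  simp only at hr hs
  subst hr
  have hΔ := P.Δ_pos.ne'
  simp only [PCQParams.field, zero_mul, Prod.mk_eq_zero, div_eq_zero_iff, true_and, hΔ, or_false] at hF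
  obtain ⟨h1, h2⟩ := hF
  have e1 : (s + k * P.ε * P.a) ^ 2 - (φ + k) ^ 2 = S ^ 2 - ψ ^ 2 := by
    refine mul_left_cancel₀ hΔ ?_
    linear_combination -h1 + h.rest_re
  have e2 : (s + k * P.ε * P.a) * (φ + k) = S * ψ := by
    refine mul_left_cancel₀ (mul_ne_zero two_ne_zero hΔ) ?_
    linear_combination -h2 - h.rest_im
  have hsq : (⟨s + k * P.ε * P.a, φ + k⟩ : ℂ) ^ 2 = ⟨S, ψ⟩ ^ 2 := by
    refine Complex.ext ?_ ?_ <;> simp only [pow_two, Complex.mul_re, Complex.mul_im]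
    · linear_combination e1
    · linear_combination 2 * e2
  have hg := h.growth
  rcases sq_eq_sq_iff_eq_or_eq_neg.1 hsq with h3 | h3
  · have h4 := congrArg Complex.re h3
    have h5 := congrArg Complex.im h3
    simp only at h4 h5
    exact Prod.ext rfl (Prod.ext (by simp only; linarith) (by simp only; linarith))
  · have h4 := congrArg Complex.re h3
    simp only [Complex.neg_re] at h4
    linarith

/-- Every unstable orbit is a translate of the profile orbit. -/
theorem IsProfile.apply_zero_eq (h : IsProfile P k σ S ψ l f g Y)
    (hS : 0 < S + k * P.ε * P.a) {η η' τ : ℝ} (hη0 : 0 < η) (hη : Real.exp (2 * σ * η) ≤ 2) (hη' : 0 < η')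
    {v : ℝ → ℝ × ℝ × ℝ} (hv : P.IsUnstableOrbit (2 * P.Δ * k) η' v) (hτ : FirstCrossing η' v τ)
    (hτη : -τ < η) : v 0 = profileOrbit σ ψ k f g Y (-τ) := by
  obtain ⟨hud, hur, -⟩ := h.isUnstableOrbit hη
  obtain ⟨-, hu0, hus⟩ := h.firstCrossing hη0
  obtain ⟨hvd, hvr, p, hp, hvl⟩ := hv
  obtain ⟨hτ', hv0, hvs⟩ := hτ
  have hpe := h.eq_of_isLeftRest hS hp
  subst hpe
  have hγ : 0 < 2 * σ + 2 * P.Δ * k * P.ε * P.a / P.Δ := by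
    have h1 := h.growth
    have h2 : 2 * P.Δ * k * P.ε * P.a / P.Δ = 2 * (k * P.ε * P.a) := by
      have := P.Δ_pos.ne'
      field_simp
    have := h.growth_pos
    rw [h2]
    linarith
  obtain ⟨z₁, hz₁, z₂, hz₂, he⟩ := P.exists_eq_of_tendsto hud hur hvd hvr hp hγ h.tendsto hvl
  set T := z₁ - z₂ with hT
  have heq : ∀ z < min η' (η - T), v z = profileOrbit σ ψ k f g Y (z + T) := by
    refine eqOn_Iio_of_hasDerivAt (P.contDiff_field _) (fun z hz => hvd z (hz.trans_le (min_le_left _ _)))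
      (fun z hz => ?_) (lt_min hz₂ (by rw [hT]; linarith)) (t₀ := z₂) (by rw [← he, hT]; congr 1; ring)
    have hz' : z + T < η := by linarith [hz.trans_le (min_le_right η' (η - T))]
    exact (hud (z + T) hz').comp_add_const z T
  -- If the crossings did not correspond under the translation, one orbit would have s = 0 at a time
  -- when the other still requires s > 0.
  have hτT : T = -τ := by
    rcases lt_trichotomy (τ + T) 0 with h1 | h1 | h1
    · have h2 := heq τ (lt_min hτ' (by linarith))
      have h3 := hus _ h1
      rw [← h2, hv0] at h3
      exact absurd h3 (lt_irrefl _)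
    · linarith
    · have h2 := heq (-T) (lt_min (by linarith) (by linarith))
      have h3 := hvs (-T) (by linarith)
      rw [h2, neg_add_cancel, hu0] at h3
      exact absurd h3 (lt_irrefl _)
  rw [heq 0 (lt_min hη' (by linarith)), zero_add, hτT]

end

/-- An orbit which meets the section `s = 0` at time `0` has a first component stationary there. -/
theorem abs_fst_sub_le (P : PCQParams) {c η B M : ℝ} {u : ℝ → ℝ × ℝ × ℝ}
    (hd : ∀ z < η, HasDerivAt u (P.field c (u z)) z) (hB : ∀ z < η, ‖u z‖ ≤ B)
    (hM : ∀ z < η, ‖P.field c (u z)‖ ≤ M) (h0 : (u 0).2.1 = 0) (hη : 0 < η) {z : ℝ} (hz : z < η) :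
    |(u z).1 - (u 0).1| ≤ B * M * z ^ 2 := by
  have hM0 : 0 ≤ M := (norm_nonneg _).trans (hM 0 hη)
  have hB0 : 0 ≤ B := (norm_nonneg _).trans (hB 0 hη)
  have hd1 : ∀ z < η, HasDerivAt (fun z => (u z).1) (P.field c (u z)).1 z := fun z hz => (hd z hz).fst
  have hd2 : ∀ z < η, HasDerivAt (fun z => (u z).2.1) (P.field c (u z)).2.1 z :=
    fun z hz => (hd z hz).snd.fst
  have h1 : ∀ x < η, |(u x).2.1| ≤ M * |x| := by
    intro x hx
    have := (convex_Iio η).norm_image_sub_le_of_norm_hasDerivWithin_le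
      (f := fun z => (u z).2.1) (f' := fun z => (P.field c (u z)).2.1) (C := M)
      (fun y hy => (hd2 y hy).hasDerivWithinAt)
      (fun y hy => (((norm_fst_le _).trans (norm_snd_le _)).trans (hM y hy))) hη hx
    simpa [h0] using this
  have huz : uIcc 0 z ⊆ Iio η := fun y hy => lt_of_le_of_lt hy.2 (max_lt hη hz)
  have := (convex_uIcc 0 z).norm_image_sub_le_of_norm_hasDerivWithin_le
    (f := fun z => (u z).1) (f' := fun z => (P.field c (u z)).1) (C := B * (M * |z|))
    (fun y hy => (hd1 y (huz hy)).hasDerivWithinAt)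
    (fun y hy => ?_) left_mem_uIcc right_mem_uIcc
  · calc _ ≤ _ := this
      _ = B * M * (|z| * |z|) := by rw [sub_zero, Real.norm_eq_abs]; ring
      _ = _ := by rw [abs_mul_abs_self]; ring
  · have h2 : |y| ≤ |z| := by simpa using abs_sub_left_of_mem_uIcc hy
    have h3 := (norm_fst_le (u y)).trans (hB y (huz hy))
    change ‖(u y).1 * (u y).2.1‖ ≤ _
    rw [norm_mul]
    exact mul_le_mul h3 ((h1 y (huz hy)).trans (mul_le_mul_of_nonneg_left h2 hM0)) (norm_nonneg _) hB0

/-! ### Closed forms for R₀, Λ₂' and R₀''(0) -/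

/-- The energy density of the unperturbed profile. -/
noncomputable def waveEnergyI (ω κ : ℝ) (hκ : 0 < κ) : CI :=
  amp (waveFI κ hκ) (8 * ω / κ) * (1 + CI.X * waveFI κ hκ) ^ 2

theorem waveEnergyI_apply (ω κ : ℝ) (hκ : 0 < κ) (q : Icc (0 : ℝ) 2) :
    waveEnergyI ω κ hκ q = 8 * ω / waveDen κ q * (1 + q * waveF κ q) ^ 2 := by
  rw [waveEnergyI, ContinuousMap.mul_apply, amp_waveFI]
  rfl

theorem one_add_mul_waveF {κ q : ℝ} (hκ : 0 < κ) (hq : 0 ≤ q) :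
    1 + q * waveF κ q = κ * (1 - q ^ 2) / waveDen κ q := by
  have h := waveDen_pos hκ hq
  unfold waveF
  field_simp
  unfold waveDen
  ring

theorem prim_waveEnergyI_pos {ω κ : ℝ} (hω : 0 < ω) (hκ : 0 < κ) :
    0 < CI.prim (waveEnergyI ω κ hκ) onePt := by
  rw [CI.prim_apply, CI.avg_apply]
  refine mul_pos one_pos (intervalIntegral.intervalIntegral_pos_of_pos_on
    (CI.intervalIntegrable_avg 0 _ _ _ _) (fun t ht => ?_) one_pos)
  have hm := CI.mul_mem (Ioo_subset_Icc_self ht) onePt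
  have h1 : t * ((onePt : Icc (0 : ℝ) 2) : ℝ) = t := mul_one t
  have h2 := waveDen_pos hκ ht.1.le
  rw [CI.ext_of_mem _ hm, waveEnergyI_apply]
  simp only [h1]
  rw [one_add_mul_waveF hκ ht.1.le, pow_zero, one_mul]
  have h3 : 0 < 1 - t ^ 2 := by nlinarith [ht.1, ht.2]
  positivity

section
variable {ω α : ℝ}

theorem waveR₀_eq (hω : 0 < ω) (hβ : -(16 / 3) * α * ω < 1) (z : ℝ) :
    waveR₀ ω α z = √(Real.exp (2 * √ω * z) *
      (8 * ω / waveDen (√(1 - (-(16 / 3) * α * ω))) (Real.exp (2 * √ω * z)))) := by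
  have hκ : 0 < √(1 - (-(16 / 3) * α * ω)) := Real.sqrt_pos.2 (by linarith)
  unfold waveR₀
  congr 1
  rw [Real.cosh_eq, Real.exp_neg]
  have hq := Real.exp_pos (2 * √ω * z)
  generalize Real.exp (2 * √ω * z) = q at *
  have hd := waveDen_pos hκ hq.le
  have h1 : 1 + √(1 - (-(16 / 3) * α * ω)) * ((q + q⁻¹) / 2) =
      waveDen (√(1 - (-(16 / 3) * α * ω))) q / (2 * q) := by
    unfold waveDen
    field_simp
    ring
  rw [h1]
  field_simp
  ring

theorem waveR₀_pos (hω : 0 < ω) (hβ : -(16 / 3) * α * ω < 1) (z : ℝ) : 0 < waveR₀ ω α z := by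
  have hκ : 0 < √(1 - (-(16 / 3) * α * ω)) := Real.sqrt_pos.2 (by linarith)
  rw [waveR₀_eq hω hβ]
  have := waveDen_pos hκ (Real.exp_pos (2 * √ω * z)).le
  exact Real.sqrt_pos.2 (by positivity)

theorem hasDerivAt_exp_mul (a z : ℝ) :
    HasDerivAt (fun z => Real.exp (a * z)) (a * Real.exp (a * z)) z := by
  simpa [mul_comm] using ((hasDerivAt_id z).const_mul a).exp

theorem hasDerivAt_waveR₀ (hω : 0 < ω) (hβ : -(16 / 3) * α * ω < 1) (z : ℝ) :
    HasDerivAt (waveR₀ ω α) (waveR₀ ω α z * (√ω * (1 + Real.exp (2 * √ω * z) *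
      waveF (√(1 - (-(16 / 3) * α * ω))) (Real.exp (2 * √ω * z))))) z := by
  have hκ : 0 < √(1 - (-(16 / 3) * α * ω)) := Real.sqrt_pos.2 (by linarith)
  have hR := waveR₀_pos hω hβ z
  have hR2 := waveR₀_eq hω hβ z
  have hfun := funext (waveR₀_eq hω hβ)
  set κ := √(1 - (-(16 / 3) * α * ω)) with hκdef
  have hq := Real.exp_pos (2 * √ω * z)
  have hqd := hasDerivAt_exp_mul (2 * √ω) z
  have hden := waveDen_pos hκ hq.le
  have h1 := hqd.mul ((((hasDerivAt_waveDen κ _).comp z hqd).fun_inv hden.ne').const_mul (8 * ω))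
  have hx : 0 < Real.exp (2 * √ω * z) * (8 * ω / waveDen κ (Real.exp (2 * √ω * z))) := by positivity
  have h2 := HasDerivAt.sqrt (f := fun z => Real.exp (2 * √ω * z) *
    (8 * ω / waveDen κ (Real.exp (2 * √ω * z)))) h1 hx.ne'
  rw [hfun]
  refine h2.congr_deriv ?_
  simp only
  have hs : √(Real.exp (2 * √ω * z) * (8 * ω / waveDen κ (Real.exp (2 * √ω * z)))) ≠ 0 :=
    (Real.sqrt_pos.2 hx).ne'
  rw [div_eq_iff (by positivity), show ∀ a b : ℝ, a * b * (2 * a) = 2 * b * (a ^ 2) from fun a b => by ring,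
    Real.sq_sqrt hx.le]
  simp only [Function.comp_apply, waveF]
  generalize Real.exp (2 * √ω * z) = q at *
  field_simp

/-- In the product rule only the derivative of the logarithmic slope survives, since the slope
itself vanishes at the crest q = 1. -/
theorem iteratedDeriv_two_waveR₀ (hω : 0 < ω) (hβ : -(16 / 3) * α * ω < 1) :
    iteratedDeriv 2 (waveR₀ ω α) 0 =
      waveR₀ ω α 0 * (2 * ω * waveV (√(1 - (-(16 / 3) * α * ω))) 1) := by
  have hκ : 0 < √(1 - (-(16 / 3) * α * ω)) := Real.sqrt_pos.2 (by linarith)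
  have hd : deriv (waveR₀ ω α) = fun z => waveR₀ ω α z * (√ω * (1 + Real.exp (2 * √ω * z) *
      waveF (√(1 - (-(16 / 3) * α * ω))) (Real.exp (2 * √ω * z)))) :=
    funext fun z => (hasDerivAt_waveR₀ hω hβ z).deriv
  rw [iteratedDeriv_succ, iteratedDeriv_one, hd]
  set κ := √(1 - (-(16 / 3) * α * ω)) with hκdef
  have h0 : Real.exp (2 * √ω * 0) = 1 := by simp
  have h1 := (hasDerivAt_mul_waveF hκ (Real.exp_pos (2 * √ω * 0)).le).comp (0 : ℝ)
    (hasDerivAt_exp_mul (2 * √ω) 0)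
  have h2 : HasDerivAt (fun z => waveR₀ ω α z * (√ω * (1 + Real.exp (2 * √ω * z) *
      waveF κ (Real.exp (2 * √ω * z))))) _ 0 :=
    (hasDerivAt_waveR₀ hω hβ 0).mul ((h1.const_add 1).const_mul (√ω))
  rw [h2.deriv, h0, one_add_mul_waveF hκ zero_le_one]
  have hs : √ω * √ω = ω := Real.mul_self_sqrt hω.le
  simp only [one_pow, sub_self, mul_zero, zero_div, zero_add, mul_one]
  linear_combination (2 * waveR₀ ω α 0 * waveV κ 1) * hs

/-- R₀ is even, so the integral is twice that over a half line. With q = exp(-2√ω z) and dz =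
-dq/(2√ω q), the half line becomes (0, 1) and the density becomes √ω/2 times the energy density. -/
theorem waveLambda₂'_eq (hω : 0 < ω) (hβ : -(16 / 3) * α * ω < 1)
    (hκ : 0 < √(1 - (-(16 / 3) * α * ω))) :
    waveLambda₂' ω α = √ω * CI.prim (waveEnergyI ω _ hκ) onePt := by
  have hd : ∀ z, deriv (waveR₀ ω α) z = waveR₀ ω α z * (√ω * (1 + Real.exp (2 * √ω * z) *
      waveF (√(1 - (-(16 / 3) * α * ω))) (Real.exp (2 * √ω * z)))) :=
    fun z => (hasDerivAt_waveR₀ hω hβ z).deriv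
  have heven : ∀ z, waveR₀ ω α (-z) = waveR₀ ω α z := fun z => by
    unfold waveR₀
    rw [mul_neg, Real.cosh_neg]
  have hodd : ∀ z, (deriv (waveR₀ ω α) (-z)) ^ 2 = (deriv (waveR₀ ω α) z) ^ 2 := fun z => by
    have := deriv_comp_neg (waveR₀ ω α) z
    rw [funext heven] at this
    rw [this, neg_sq]
  have habs : ∀ z, (deriv (waveR₀ ω α) z) ^ 2 = (deriv (waveR₀ ω α) |z|) ^ 2 := fun z => by
    rcases abs_choice z with h | h <;> rw [h]
    rw [hodd]
  have hsq : ∀ z, (deriv (waveR₀ ω α) z) ^ 2 = Real.exp (2 * √ω * z) *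
      (8 * ω / waveDen (√(1 - (-(16 / 3) * α * ω))) (Real.exp (2 * √ω * z))) *
      (ω * (1 + Real.exp (2 * √ω * z) *
      waveF (√(1 - (-(16 / 3) * α * ω))) (Real.exp (2 * √ω * z))) ^ 2) := fun z => by
    have := waveDen_pos hκ (Real.exp_pos (2 * √ω * z)).le
    rw [hd, mul_pow, mul_pow, Real.sq_sqrt hω.le, waveR₀_eq hω hβ, Real.sq_sqrt (by positivity)]
  set κ := √(1 - (-(16 / 3) * α * ω)) with hκdef
  set n := waveEnergyI ω κ hκ with hn
  have hsω : 0 < √ω := Real.sqrt_pos.2 hω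
  have hderiv : ∀ z ∈ Ici (0 : ℝ), HasDerivAt
      (fun z => -(√ω / 2 * (CI.prim n).ext (Real.exp (-(2 * √ω) * z))))
      ((deriv (waveR₀ ω α) z) ^ 2) z := by
    intro z hz
    have hq1 : Real.exp (-(2 * √ω) * z) ≤ 1 := by
      rw [Real.exp_le_one_iff]
      have : 0 ≤ z := hz
      nlinarith [mul_nonneg hsω.le this]
    have hqm : Real.exp (-(2 * √ω) * z) ∈ Ioo (0 : ℝ) 2 := ⟨Real.exp_pos _, by linarith⟩
    refine ((((CI.hasDerivAt_ext_prim n hqm).comp z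
      (hasDerivAt_exp_mul (-(2 * √ω)) z)).const_mul (√ω / 2)).neg).congr_deriv ?_
    rw [← hodd, hsq, CI.ext_of_mem _ (Ioo_subset_Icc_self hqm), hn, waveEnergyI_apply]
    have hs : √ω * √ω = ω := Real.mul_self_sqrt hω.le
    simp only [show 2 * √ω * -z = -(2 * √ω) * z by ring]
    generalize Real.exp (-(2 * √ω) * z) = q
    linear_combination (8 * ω / waveDen κ q * q * (1 + q * waveF κ q) ^ 2) * hs
  have hlim : Tendsto (fun z => -(√ω / 2 * (CI.prim n).ext (Real.exp (-(2 * √ω) * z)))) atTop (𝓝 0) := by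
    have h0 : (CI.prim n).ext 0 = 0 := by
      rw [CI.ext_of_mem _ ⟨le_rfl, zero_le_two⟩, CI.prim_apply, zero_mul]
    have h1 : Tendsto (fun z => Real.exp (-(2 * √ω) * z)) atTop (𝓝 0) :=
      Real.tendsto_exp_atBot.comp (tendsto_id.const_mul_atTop_of_neg (by linarith))
    have := ((((CI.prim n).continuous_ext.tendsto 0).comp h1).const_mul (√ω / 2)).neg
    simpa [h0] using this
  have hI := integral_Ioi_of_hasDerivAt_of_nonneg' hderiv (fun _ _ => sq_nonneg _) hlim
  have h1 : (CI.prim n).ext 1 = CI.prim n onePt := CI.ext_of_mem _ onePt.2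
  unfold waveLambda₂'
  rw [show (fun z => (deriv (waveR₀ ω α) z) ^ 2) = fun z => (deriv (waveR₀ ω α) |z|) ^ 2 from funext habs,
    integral_comp_abs (f := fun z => (deriv (waveR₀ ω α) z) ^ 2), hI, mul_zero, Real.exp_zero, h1]
  ring

theorem waveN_neg (hω : 0 < ω) (hβ : -(16 / 3) * α * ω < 1) : waveN ω α < 0 := by
  have hκ : 0 < √(1 - (-(16 / 3) * α * ω)) := Real.sqrt_pos.2 (by linarith)
  unfold waveN
  rw [waveLambda₂'_eq hω hβ hκ, iteratedDeriv_two_waveR₀ hω hβ]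
  refine div_neg_of_pos_of_neg (mul_pos (Real.sqrt_pos.2 hω) (prim_waveEnergyI_pos hω hκ)) ?_
  have h1 := mul_neg_of_pos_of_neg (mul_pos two_pos hω) (waveV_neg hκ zero_le_one)
  exact mul_neg_of_pos_of_neg two_pos (mul_neg_of_pos_of_neg (waveR₀_pos hω hβ 0) h1)

end

/-! ### Energy balance of a profile -/

/-- The energy balance of a profile with real coefficients. -/
theorem profile_energy {l : Fin 6 → ℝ} {f g : CI} {Y : ℝ} (h : profileEq (l, f, g, Y) = 0)
    (h1 : l 1 = 0) :
    -(1 + 2 * l 0) * amp f Y onePt + l 2 / 2 * amp f Y onePt ^ 2 + l 4 / 3 * amp f Y onePt ^ 3 =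
      CI.prim ((-2 * l 0) • (amp f Y * (1 + CI.X * f) ^ 2) +
        amp f Y * (1 + CI.X * f) * (CI.X * g) ^ 2) onePt := by
  obtain ⟨hf, -, hf1⟩ := eq_smul_avg_of_profileEq h
  set y := amp f Y with hy
  set n : CI := (-2 * l 0) • (y * (1 + CI.X * f) ^ 2) + y * (1 + CI.X * f) * (CI.X * g) ^ 2 with hn
  have hfc := f.continuous_ext
  have hyc := y.continuous_ext
  -- With x = r² and 1 + qf = s/σ, the first term is (r'/σ)² and the others form the potential. The
  -- total is conserved up to the damping `l 0` and the coupling to g. It vanishes at q = 0, and its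
  -- kinetic part vanishes at q = 1.
  have hderiv : ∀ q ∈ Ioo (0 : ℝ) 1, HasDerivAt (fun q => q * y.ext q * (1 + q * f.ext q) ^ 2 -
      (1 + 2 * l 0) * (q * y.ext q) + l 2 / 2 * (q * y.ext q) ^ 2 + l 4 / 3 * (q * y.ext q) ^ 3)
      (n.ext q) q := by
    intro q hq
    have hq2 : q ∈ Ioo (0 : ℝ) 2 := ⟨hq.1, hq.2.trans one_lt_two⟩
    have dx : HasDerivAt (fun q => q * y.ext q) (1 * y.ext q + q * (y.ext q * f.ext q)) q :=
      (hasDerivAt_id q).mul (hasDerivAt_ext_amp f Y hq2)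
    have dh := (hasDerivAt_mul_ext hf hq2).const_add 1
    refine ((((dx.mul (dh.pow 2)).sub (dx.const_mul (1 + 2 * l 0))).add
      ((dx.pow 2).const_mul (l 2 / 2))).add ((dx.pow 3).const_mul (l 4 / 3))).congr_deriv ?_
    have hone : (1 : CI).ext q = 1 := rfl
    simp only [hn, profileRe, CI.ext_add, CI.ext_sub, CI.ext_mul, CI.ext_smul, CI.ext_pow, hone,
      CI.ext_X (Ioo_subset_Icc_self hq2), h1, Pi.pow_apply]
    push_cast
    ring
  have hint := intervalIntegral.integral_eq_sub_of_hasDerivAt_of_le zero_le_one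
    (Continuous.continuousOn (by fun_prop)) hderiv (n.continuous_ext.intervalIntegrable _ _)
  have e1 : ((onePt : Icc (0 : ℝ) 2) : ℝ) = 1 := rfl
  have e2 : f.ext 1 = -1 := by rw [← hf1]; exact CI.ext_of_mem f onePt.2
  have e3 : y.ext 1 = y onePt := CI.ext_of_mem y onePt.2
  rw [CI.prim_apply, CI.avg_apply, e1, one_mul]
  simp only [pow_zero, one_mul, mul_one]
  rw [hint, e2, e3]
  ring

theorem differentiableAt_amp {f : ℝ → CI} {Y : ℝ → ℝ} {f' : CI} {Y' t : ℝ} (hf : HasDerivAt f f' t)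
    (hY : HasDerivAt Y Y' t) : DifferentiableAt ℝ (fun s => amp (f s) (Y s)) t :=
  DifferentiableAt.comp (g := fun x : CI × ℝ => amp x.1 x.2) t
    ((contDiff_amp (n := 1)).differentiable one_ne_zero (f t, Y t))
    (hf.differentiableAt.prodMk hY.differentiableAt)

/-- The energy balance, differentiated along a curve of profiles. -/
theorem profile_energy_deriv {l : ℝ → Fin 6 → ℝ} {f g : ℝ → CI} {Y : ℝ → ℝ} {f' g' : CI}
    {Y' m₀ m₂ m₄ : ℝ} (hf : HasDerivAt f f' 0) (hg : HasDerivAt g g' 0) (hY : HasDerivAt Y Y' 0)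
    (hl0 : HasDerivAt (fun t => l t 0) m₀ 0) (hl2 : HasDerivAt (fun t => l t 2) m₂ 0)
    (hl4 : HasDerivAt (fun t => l t 4) m₄ 0) (h0 : l 0 0 = 0) (hg0 : g 0 = 0)
    (h1 : ∀ᶠ t in 𝓝 (0 : ℝ), l t 1 = 0)
    (h : ∀ᶠ t in 𝓝 (0 : ℝ), profileEq (l t, f t, g t, Y t) = 0) :
    ∃ x', HasDerivAt (fun t => amp (f t) (Y t) onePt) x' 0 ∧
      (-1 + l 0 2 * amp (f 0) (Y 0) onePt + l 0 4 * amp (f 0) (Y 0) onePt ^ 2) * x' +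
        (-2 * m₀ * amp (f 0) (Y 0) onePt + m₂ / 2 * amp (f 0) (Y 0) onePt ^ 2 +
          m₄ / 3 * amp (f 0) (Y 0) onePt ^ 3) =
      -2 * m₀ * CI.prim (amp (f 0) (Y 0) * (1 + CI.X * f 0) ^ 2) onePt := by
  have hy := (differentiableAt_amp hf hY).hasDerivAt
  set y' := deriv (fun s => amp (f s) (Y s)) 0 with hy'
  have hx : HasDerivAt (fun t => amp (f t) (Y t) onePt) (y' onePt) 0 :=
    (ContinuousMap.evalCLM ℝ onePt : CI →L[ℝ] ℝ).hasFDerivAt.comp_hasDerivAt (0 : ℝ) hy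
  refine ⟨y' onePt, hx, ?_⟩
  have hX : HasDerivAt (fun _ : ℝ => CI.X) 0 0 := hasDerivAt_const _ _
  have hh := (hX.mul hf).const_add (1 : CI)
  have hXg := hX.mul hg
  have hL : HasDerivAt (fun t => -(1 + 2 * l t 0) * amp (f t) (Y t) onePt +
      l t 2 / 2 * amp (f t) (Y t) onePt ^ 2 + l t 4 / 3 * amp (f t) (Y t) onePt ^ 3)
      ((-1 + l 0 2 * amp (f 0) (Y 0) onePt + l 0 4 * amp (f 0) (Y 0) onePt ^ 2) * y' onePt +
        (-2 * m₀ * amp (f 0) (Y 0) onePt + m₂ / 2 * amp (f 0) (Y 0) onePt ^ 2 +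
          m₄ / 3 * amp (f 0) (Y 0) onePt ^ 3)) 0 := by
    refine (((((hl0.const_mul 2).const_add 1).neg.mul hx).add ((hl2.div_const 2).mul (hx.pow 2))).add
      ((hl4.div_const 3).mul (hx.pow 3))).congr_deriv ?_
    simp [h0]
    ring
  -- At the base point `l 0 = 0` and g = 0. The g-term is quadratic, so it drops out, and only the
  -- explicit variation of the damping remains.
  have hn : HasDerivAt (fun t => (-2 * l t 0) • (amp (f t) (Y t) * (1 + CI.X * f t) ^ 2) +
      amp (f t) (Y t) * (1 + CI.X * f t) * (CI.X * g t) ^ 2)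
      ((-2 * m₀) • (amp (f 0) (Y 0) * (1 + CI.X * f 0) ^ 2)) 0 := by
    refine ((((hl0.const_mul (-2)).smul (hy.mul (hh.mul hh))).add
      ((hy.mul hh).mul (hXg.mul hXg))).congr_of_eventuallyEq
      (Eventually.of_forall fun t => ?_)).congr_deriv ?_
    · simp [pow_two]
    · simp [h0, hg0, pow_two]
  have hR := ((ContinuousMap.evalCLM ℝ onePt : CI →L[ℝ] ℝ) ∘L CI.prim).hasFDerivAt.comp_hasDerivAt
    (0 : ℝ) hn
  have heq := hL.unique (hR.congr_of_eventuallyEq ?_)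
  · rw [heq]
    simp [mul_assoc]
  · filter_upwards [h, h1] with t ht ht1 using profile_energy ht ht1

/-! ### The family of profiles and its parameters -/

/-- The smooth family of profiles provided by the implicit function theorem. -/
theorem exists_profile_family {ω κ : ℝ} (hω : 0 < ω) (hκ : 0 < κ) :
    ∃ U : (Fin 6 → ℝ) → CI × CI × ℝ,
      ContDiffAt ℝ 2 U (baseParam (1 / ω) (3 * (κ ^ 2 - 1) / (16 * ω ^ 2))) ∧
      U (baseParam (1 / ω) (3 * (κ ^ 2 - 1) / (16 * ω ^ 2))) = (waveFI κ hκ, 0, 8 * ω / κ) ∧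
      ∀ᶠ l in 𝓝 (baseParam (1 / ω) (3 * (κ ^ 2 - 1) / (16 * ω ^ 2))), profileEq (l, U l) = 0 := by
  have hc : ContDiffAt ℝ 2 profileEq
      (baseParam (1 / ω) (3 * (κ ^ 2 - 1) / (16 * ω ^ 2)), waveFI κ hκ, 0, 8 * ω / κ) :=
    contDiff_profileEq.contDiffAt
  have hi := isInvertible_fderiv_profileEq_wave ω κ hω hκ
  refine ⟨hc.implicitFunction two_ne_zero hi, hc.contDiffAt_implicitFunction two_ne_zero hi,
    hc.implicitFunction_apply_self two_ne_zero hi, ?_⟩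
  filter_upwards [hc.eventually_apply_implicitFunction two_ne_zero hi] with l hl
  rw [hl, profileEq_wave ω κ hω hκ]

/-- The real part of the square of the rest state, in terms of `p = (γ, μ, ε, e)`, where
`γ = c ε a / (2Δ)`, `μ = c²` and `e = ε d₁`. -/
noncomputable def restW (ω a b : ℝ) (p : ℝ × ℝ × ℝ × ℝ) : ℝ :=
  (ω - p.2.2.1 ^ 2 * a * b) / (1 + p.2.2.1 ^ 2 * a ^ 2) -
    p.2.1 * (1 - p.2.2.1 ^ 2 * a ^ 2) / (4 * (1 + p.2.2.1 ^ 2 * a ^ 2) ^ 2)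

/-- Minus the imaginary part of the square of the rest state. -/
noncomputable def restE (ω a b : ℝ) (p : ℝ × ℝ × ℝ × ℝ) : ℝ :=
  p.2.2.1 * (b + a * ω) / (1 + p.2.2.1 ^ 2 * a ^ 2) -
    p.2.1 * p.2.2.1 * a / (2 * (1 + p.2.2.1 ^ 2 * a ^ 2) ^ 2)

/-- The real part of the rest state. -/
noncomputable def restRe (ω a b : ℝ) (p : ℝ × ℝ × ℝ × ℝ) : ℝ :=
  √((restW ω a b p + √(restW ω a b p ^ 2 + restE ω a b p ^ 2)) / 2)

/-- The imaginary part of the rest state. -/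
noncomputable def restIm (ω a b : ℝ) (p : ℝ × ℝ × ℝ × ℝ) : ℝ :=
  -restE ω a b p / (2 * restRe ω a b p)

/-- The coefficients of the profile equation in terms of `p = (γ, μ, ε, e)`. -/
noncomputable def profileParam (ω α a b d₂ : ℝ) (p : ℝ × ℝ × ℝ × ℝ) : Fin 6 → ℝ :=
  ![restRe ω a b p / (restRe ω a b p - p.1) - 1, restIm ω a b p / (restRe ω a b p - p.1),
    (1 + p.2.2.1 * a * p.2.2.2) / ((1 + p.2.2.1 ^ 2 * a ^ 2) * (restRe ω a b p - p.1) ^ 2),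
    (p.2.2.2 - p.2.2.1 * a) / ((1 + p.2.2.1 ^ 2 * a ^ 2) * (restRe ω a b p - p.1) ^ 2),
    (α + p.2.2.1 ^ 2 * a * d₂) / ((1 + p.2.2.1 ^ 2 * a ^ 2) * (restRe ω a b p - p.1) ^ 2),
    p.2.2.1 * (d₂ - a * α) / ((1 + p.2.2.1 ^ 2 * a ^ 2) * (restRe ω a b p - p.1) ^ 2)]

section
variable {ω α a b d₂ : ℝ}

theorem restW_line (γ : ℝ) : restW ω a b (γ, 0, 0, 0) = ω := by simp [restW]
theorem restE_line (γ : ℝ) : restE ω a b (γ, 0, 0, 0) = 0 := by simp [restE]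
theorem restRe_line (hω : 0 < ω) (γ : ℝ) : restRe ω a b (γ, 0, 0, 0) = √ω := by
  simp [restRe, restW_line, restE_line, Real.sqrt_sq hω.le]
theorem restIm_line (γ : ℝ) : restIm ω a b (γ, 0, 0, 0) = 0 := by
  simp [restIm, restE_line]

/-- On the γ-axis the rest state stays at √ω and only σ = √ω - γ moves; every derivative in γ is
read off from here. -/
theorem profileParam_line (hω : 0 < ω) (γ : ℝ) : profileParam ω α a b d₂ (γ, 0, 0, 0) =
    ![√ω / (√ω - γ) - 1, 0, 1 / (√ω - γ) ^ 2, 0, α / (√ω - γ) ^ 2, 0] := by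
  simp [profileParam, restRe_line hω, restIm_line]

theorem contDiffAt_restW {n : WithTop ℕ∞} (p : ℝ × ℝ × ℝ × ℝ) : ContDiffAt ℝ n (restW ω a b) p := by
  have h1 : 1 + p.2.2.1 ^ 2 * a ^ 2 ≠ 0 := by positivity
  unfold restW
  exact ContDiffAt.sub (ContDiffAt.div (by fun_prop) (by fun_prop) h1)
    (ContDiffAt.div (by fun_prop) (by fun_prop) (by positivity))

theorem contDiffAt_restE {n : WithTop ℕ∞} (p : ℝ × ℝ × ℝ × ℝ) : ContDiffAt ℝ n (restE ω a b) p := by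
  have h1 : 1 + p.2.2.1 ^ 2 * a ^ 2 ≠ 0 := by positivity
  unfold restE
  exact ContDiffAt.sub (ContDiffAt.div (by fun_prop) (by fun_prop) h1)
    (ContDiffAt.div (by fun_prop) (by fun_prop) (by positivity))

theorem contDiffAt_restRe {n : WithTop ℕ∞} (hω : 0 < ω) : ContDiffAt ℝ n (restRe ω a b) 0 := by
  have hW : restW ω a b 0 = ω := restW_line 0
  have hE : restE ω a b 0 = 0 := restE_line 0
  have h1 := contDiffAt_restW (n := n) (ω := ω) (a := a) (b := b) 0
  have h2 := contDiffAt_restE (n := n) (ω := ω) (a := a) (b := b) 0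
  have h3 := ((h1.pow 2).add (h2.pow 2)).sqrt (by rw [hW, hE]; positivity)
  refine ((h1.add h3).div_const 2).sqrt ?_
  rw [hW, hE]
  positivity

theorem contDiffAt_restIm {n : WithTop ℕ∞} (hω : 0 < ω) : ContDiffAt ℝ n (restIm ω a b) 0 := by
  refine (contDiffAt_restE 0).neg.div (contDiffAt_const.mul (contDiffAt_restRe hω)) ?_
  rw [show restRe ω a b 0 = √ω from restRe_line hω 0]
  positivity

theorem contDiffAt_profileParam {n : WithTop ℕ∞} (hω : 0 < ω) :
    ContDiffAt ℝ n (profileParam ω α a b d₂) 0 := by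
  have h1 := contDiffAt_restRe (n := n) (a := a) (b := b) hω
  have h2 := contDiffAt_restIm (n := n) (a := a) (b := b) hω
  have hσ : ContDiffAt ℝ n (fun p : ℝ × ℝ × ℝ × ℝ => restRe ω a b p - p.1) 0 :=
    h1.sub contDiffAt_fst
  have h0 : restRe ω a b 0 - (0 : ℝ × ℝ × ℝ × ℝ).1 ≠ 0 := by
    rw [show restRe ω a b 0 = √ω from restRe_line hω 0]
    simpa using (Real.sqrt_pos.2 hω).ne'
  have hD : ContDiffAt ℝ n (fun p : ℝ × ℝ × ℝ × ℝ =>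
      (1 + p.2.2.1 ^ 2 * a ^ 2) * (restRe ω a b p - p.1) ^ 2) 0 := by
    refine ContDiffAt.mul (by fun_prop) (hσ.pow 2)
  have hD0 : (1 + (0 : ℝ × ℝ × ℝ × ℝ).2.2.1 ^ 2 * a ^ 2) *
      (restRe ω a b 0 - (0 : ℝ × ℝ × ℝ × ℝ).1) ^ 2 ≠ 0 :=
    mul_ne_zero (by positivity) (pow_ne_zero 2 h0)
  rw [contDiffAt_pi]
  intro i
  fin_cases i
  · exact (h1.div hσ h0).sub contDiffAt_const
  · exact h2.div hσ h0
  · exact ContDiffAt.div (by fun_prop) hD hD0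
  · exact ContDiffAt.div (by fun_prop) hD hD0
  · exact ContDiffAt.div (by fun_prop) hD hD0
  · exact ContDiffAt.div (by fun_prop) hD hD0

/-- The half-angle formula for the complex square root of W - iE, on the branch with positive real
part. -/
theorem restRe_restIm {p : ℝ × ℝ × ℝ × ℝ} (hW : 0 < restW ω a b p) :
    0 < restRe ω a b p ∧ restRe ω a b p ^ 2 - restIm ω a b p ^ 2 = restW ω a b p ∧
      2 * restRe ω a b p * restIm ω a b p = -restE ω a b p := by
  have hq : 0 ≤ restW ω a b p ^ 2 + restE ω a b p ^ 2 := by positivity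
  have hs := Real.sq_sqrt hq
  have hs0 := Real.sqrt_nonneg (restW ω a b p ^ 2 + restE ω a b p ^ 2)
  have hpos : 0 < restRe ω a b p := Real.sqrt_pos.2 (by linarith)
  have hsq : restRe ω a b p ^ 2 = (restW ω a b p + √(restW ω a b p ^ 2 + restE ω a b p ^ 2)) / 2 :=
    Real.sq_sqrt (by linarith)
  have h2 : 2 * restRe ω a b p * restIm ω a b p = -restE ω a b p := by
    unfold restIm
    field_simp
  refine ⟨hpos, ?_, h2⟩
  have h3 : 4 * restRe ω a b p ^ 2 * restIm ω a b p ^ 2 = restE ω a b p ^ 2 := by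
    linear_combination (2 * restRe ω a b p * restIm ω a b p - restE ω a b p) * h2
  have h4 : (restRe ω a b p ^ 2) * (restRe ω a b p ^ 2 - restIm ω a b p ^ 2 - restW ω a b p) = 0 := by
    have : restRe ω a b p ^ 2 * restRe ω a b p ^ 2 - restRe ω a b p ^ 2 * restW ω a b p =
        restE ω a b p ^ 2 / 4 := by
      rw [hsq]
      linear_combination hs / 4
    linear_combination this - h3 / 4
  have := (mul_eq_zero.1 h4).resolve_left (by positivity)
  linarith

theorem isProfile_of_param {p : ℝ × ℝ × ℝ × ℝ} {P : PCQParams} {k : ℝ} {f g : CI} {Y : ℝ}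
    (hPω : P.ω = ω) (hPα : P.α = α) (hPa : P.a = a) (hPb : P.b = b) (hPd : P.d₂ = d₂)
    (hp : p = (k * P.ε * P.a, (2 * P.Δ * k) ^ 2, P.ε, P.ε * P.d₁))
    (hW : 0 < restW ω a b p) (hσ : 0 < restRe ω a b p - p.1)
    (heq : profileEq (profileParam ω α a b d₂ p, f, g, Y) = 0) (hY : 0 < Y)
    (hs : ∀ q, profileSlope (profileParam ω α a b d₂ p) f g Y q < 0) :
    IsProfile P k (restRe ω a b p - p.1) (restRe ω a b p) (restIm ω a b p)
      (profileParam ω α a b d₂ p) f g Y := by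
  obtain ⟨hpos, h1, h2⟩ := restRe_restIm hW
  have hΔ := P.Δ_pos.ne'
  have hΔ' : 1 + P.ε ^ 2 * P.a ^ 2 = P.Δ := rfl
  subst hPω hPα hPa hPb hPd
  refine ⟨hσ, by rw [hp], ?_, ?_, ?_, ?_, ?_, ?_, ?_, ?_, heq, hY, hs⟩
  · rw [h1]
    simp only [restW, hp, hΔ']
    field_simp
    ring
  · have : -2 * restRe P.ω P.a P.b p * restIm P.ω P.a P.b p = restE P.ω P.a P.b p := by linarith
    rw [this]
    simp only [restE, hp, hΔ']
    field_simp
    ring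
  · simp only [profileParam, Matrix.cons_val]
    field_simp
  · simp only [profileParam, Matrix.cons_val]
    field_simp
  all_goals
    have h3 : p.2.2.1 = P.ε := by rw [hp]
    have h4 : p.2.2.2 = P.ε * P.d₁ := by rw [hp]
    simp only [profileParam, Matrix.cons_val, h3, h4, hΔ']
    generalize restRe P.ω P.a P.b p - p.1 = s at hσ
    field_simp

end

/-! ### Persistence of the orbit and derivative of its amplitude -/

theorem continuous_profileSlope :
    Continuous fun x : (Fin 6 → ℝ) × (CI × CI × ℝ) => profileSlope x.1 x.2.1 x.2.2.1 x.2.2.2 := by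
  have hA : Continuous (fun x : (Fin 6 → ℝ) × (CI × CI × ℝ) => amp x.2.1 x.2.2.2) :=
    (contDiff_amp (n := 0)).continuous.comp
      (by fun_prop : Continuous (fun x : (Fin 6 → ℝ) × (CI × CI × ℝ) => (x.2.1, x.2.2.2)))
  unfold profileSlope profileRe
  fun_prop

theorem profileSlope_wave {ω κ : ℝ} (hω : 0 < ω) (hκ : 0 < κ) :
    profileSlope (baseParam (1 / ω) (3 * (κ ^ 2 - 1) / (16 * ω ^ 2))) (waveFI κ hκ) 0 (8 * ω / κ) =
      waveVI κ hκ := by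
  ext q
  have h := waveDen_pos hκ q.2.1
  simp only [profileSlope, profileRe, baseParam, ContinuousMap.add_apply, ContinuousMap.sub_apply,
    ContinuousMap.neg_apply, ContinuousMap.smul_apply, ContinuousMap.mul_apply,
    ContinuousMap.pow_apply, amp_waveFI, CI.X_apply, waveFI_apply, waveVI_apply, waveF, waveV]
  simp
  field_simp
  unfold waveDen
  ring

/-- A continuous function on a compact interval that is negative stays so under small
perturbations. -/
theorem eventually_neg_of_tendsto {β : Type*} {F : Filter β} {s : β → CI} {s₀ : CI}
    (hs : Tendsto s F (𝓝 s₀)) (h0 : ∀ q, s₀ q < 0) : ∀ᶠ x in F, ∀ q, s x q < 0 := by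
  obtain ⟨q₀, -, hq₀⟩ := isCompact_univ.exists_isMaxOn ⟨onePt, mem_univ _⟩ s₀.continuous.continuousOn
  filter_upwards [Metric.tendsto_nhds.1 hs (-s₀ q₀) (neg_pos.2 (h0 q₀))] with x hx q
  have h1 := ContinuousMap.dist_apply_le_dist (f := s x) (g := s₀) q
  have h2 := (le_abs_self _).trans_eq (Real.dist_eq (s x q) (s₀ q)).symm
  have h3 : s₀ q ≤ s₀ q₀ := hq₀ (mem_univ q)
  linarith

theorem waveParam_eq {ω α : ℝ} (hω : 0 < ω) (hβ : -(16 / 3) * α * ω < 1) :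
    α / ω = 3 * (√(1 - (-(16 / 3) * α * ω)) ^ 2 - 1) / (16 * ω ^ 2) := by
  rw [Real.sq_sqrt (by linarith)]
  field_simp
  ring

/-- The derivative, with respect to the damping, of the amplitude at the section. -/
theorem wave_amplitude_deriv {ω κ x' : ℝ} (hω : 0 < ω) (hκ : 0 < κ) (I : ℝ)
    (h : (-1 + 1 / ω * (8 * ω / waveDen κ 1) +
        3 * (κ ^ 2 - 1) / (16 * ω ^ 2) * (8 * ω / waveDen κ 1) ^ 2) * x' +
      (-2 * (√ω)⁻¹ * (8 * ω / waveDen κ 1) + 2 * (√ω ^ 3)⁻¹ / 2 * (8 * ω / waveDen κ 1) ^ 2 +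
        2 * (3 * (κ ^ 2 - 1) / (16 * ω)) * (√ω ^ 3)⁻¹ / 3 * (8 * ω / waveDen κ 1) ^ 3) =
      -2 * (√ω)⁻¹ * I) :
    x' = √ω * I / (ω * waveV κ 1) := by
  have hs : 0 < √ω := Real.sqrt_pos.2 hω
  obtain ⟨t, ht, rfl⟩ : ∃ t, 0 < t ∧ ω = t ^ 2 := ⟨√ω, hs, (Real.sq_sqrt hω.le).symm⟩
  rw [Real.sqrt_sq ht.le] at h ⊢
  have e1 : waveDen κ 1 = 2 * (1 + κ) := by unfold waveDen; ring
  have hk : (1 + κ) ≠ 0 := by positivity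
  have e2 : waveV κ 1 = -κ / (1 + κ) := by
    unfold waveV
    rw [e1]
    field_simp
    ring
  -- This is the derivative of the potential, in x = r², at the crest of the unperturbed wave; it is
  -- nonzero there.
  have e3 : -1 + 1 / t ^ 2 * (8 * t ^ 2 / waveDen κ 1) +
      3 * (κ ^ 2 - 1) / (16 * (t ^ 2) ^ 2) * (8 * t ^ 2 / waveDen κ 1) ^ 2 = 2 * κ / (1 + κ) := by
    rw [e1]
    field_simp
    ring
  -- The explicit variation of the potential cancels. Multiplied by σ², the potential is -(ω - γ²)x
  -- + x²/2 + αx³/3, stationary in γ at 0. The variation of the prefactor σ⁻² multiplies the value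
  -- of the potential at the crest, which is zero.
  have e4 : -2 * t⁻¹ * (8 * t ^ 2 / waveDen κ 1) + 2 * (t ^ 3)⁻¹ / 2 * (8 * t ^ 2 / waveDen κ 1) ^ 2 +
        2 * (3 * (κ ^ 2 - 1) / (16 * t ^ 2)) * (t ^ 3)⁻¹ / 3 * (8 * t ^ 2 / waveDen κ 1) ^ 3 = 0 := by
    rw [e1]
    field_simp
    ring
  rw [e3, e4] at h
  rw [e2]
  field_simp at h ⊢
  linarith

/-- The family of profile orbits, its amplitude `ρ` at the section, and the derivative of `ρ` with
respect to the damping parameter. -/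
theorem exists_orbit_family {ω α : ℝ} (a b d₂ : ℝ) (hω : 0 < ω) (hβ : -(16 / 3) * α * ω < 1) :
    ∃ ρ : ℝ × ℝ × ℝ × ℝ → ℝ, ContDiffAt ℝ 2 ρ 0 ∧
      HasDerivAt (fun γ : ℝ => ρ (γ, 0, 0, 0)) (2 * waveN ω α) 0 ∧
      ∃ η > 0, ∃ C : ℝ, ∀ᶠ p in 𝓝 (0 : ℝ × ℝ × ℝ × ℝ), ∃ (f g : CI) (Y : ℝ),
        (0 < restW ω a b p ∧ 0 < restRe ω a b p - p.1 ∧ 0 < restRe ω a b p + p.1 ∧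
          profileEq (profileParam ω α a b d₂ p, f, g, Y) = 0 ∧ 0 < Y ∧
          ∀ q, profileSlope (profileParam ω α a b d₂ p) f g Y q < 0) ∧
        Real.exp (2 * (restRe ω a b p - p.1) * η) ≤ 2 ∧ |restRe ω a b p - p.1| ≤ C ∧
        |restIm ω a b p| ≤ C ∧ ‖f‖ ≤ C ∧ ‖g‖ ≤ C ∧ ‖amp f Y‖ ≤ C ∧ √(amp f Y onePt) = ρ p := by
  have hκ : 0 < √(1 - (-(16 / 3) * α * ω)) := Real.sqrt_pos.2 (by linarith)
  have hα := waveParam_eq hω hβ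
  have hN : waveN ω α = √ω * CI.prim (waveEnergyI ω _ hκ) onePt /
      (2 * (waveR₀ ω α 0 * (2 * ω * waveV (√(1 - (-(16 / 3) * α * ω))) 1))) := by
    rw [waveN, waveLambda₂'_eq hω hβ hκ, iteratedDeriv_two_waveR₀ hω hβ]
  have hR0 : waveR₀ ω α 0 = √(8 * ω / waveDen (√(1 - (-(16 / 3) * α * ω))) 1) := by
    rw [waveR₀_eq hω hβ]
    simp
  generalize √(1 - (-(16 / 3) * α * ω)) = κ at *
  have hα' : α = 3 * (κ ^ 2 - 1) / (16 * ω) := by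
    rw [(div_eq_iff hω.ne').1 hα]
    field_simp
  have hs : 0 < √ω := Real.sqrt_pos.2 hω
  obtain ⟨U, hU, hU0, hUeq⟩ := exists_profile_family hω hκ
  have hl0 : profileParam ω α a b d₂ 0 = baseParam (1 / ω) (3 * (κ ^ 2 - 1) / (16 * ω ^ 2)) := by
    rw [← hα]
    refine (profileParam_line hω 0).trans ?_
    simp [baseParam, Real.sq_sqrt hω.le, hs.ne']
  have hlc : ContDiffAt ℝ 2 (profileParam ω α a b d₂) 0 := contDiffAt_profileParam hω
  set u : ℝ × ℝ × ℝ × ℝ → CI × CI × ℝ := fun p => U (profileParam ω α a b d₂ p) with hu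
  have hu0 : u 0 = (waveFI κ hκ, 0, 8 * ω / κ) := by rw [hu]; simp only; rw [hl0, hU0]
  have huc : ContDiffAt ℝ 2 u 0 := ContDiffAt.comp 0 (by rw [hl0]; exact hU) hlc
  have hueq : ∀ᶠ p in 𝓝 (0 : ℝ × ℝ × ℝ × ℝ), profileEq (profileParam ω α a b d₂ p, u p) = 0 :=
    hlc.continuousAt.tendsto.eventually (by rw [hl0]; exact hUeq)
  have hAc : ContDiffAt ℝ 2 (fun p => amp (u p).1 (u p).2.2) 0 :=
    (contDiff_amp (n := 2)).contDiffAt.comp (0 : ℝ × ℝ × ℝ × ℝ)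
      (g := fun x : CI × ℝ => amp x.1 x.2) (f := fun p => ((u p).1, (u p).2.2))
      (huc.fst.prodMk huc.snd.snd)
  have hAe : ContDiffAt ℝ 2 (fun p => amp (u p).1 (u p).2.2 onePt) 0 :=
    (ContinuousMap.evalCLM ℝ onePt : CI →L[ℝ] ℝ).contDiff.contDiffAt.comp (0 : ℝ × ℝ × ℝ × ℝ) hAc
  have hx0 : amp (u 0).1 (u 0).2.2 onePt = 8 * ω / waveDen κ 1 := by
    rw [hu0]
    exact amp_waveFI ω κ hκ onePt
  have hx0pos : 0 < amp (u 0).1 (u 0).2.2 onePt := by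
    rw [hx0]
    have := waveDen_pos hκ zero_le_one
    positivity
  refine ⟨fun p => √(amp (u p).1 (u p).2.2 onePt), hAe.sqrt hx0pos.ne', ?_, ?_⟩
  · have hline : HasDerivAt (fun γ : ℝ => ((γ, 0, 0, 0) : ℝ × ℝ × ℝ × ℝ)) (1, 0, 0, 0) 0 :=
      (hasDerivAt_id _).prodMk (hasDerivAt_const _ _)
    have hd := (huc.differentiableAt two_ne_zero).hasFDerivAt.comp_hasDerivAt (0 : ℝ) hline
    have hf := hd.fst
    have hg := hd.snd.fst
    have hY := hd.snd.snd
    have hγ : HasDerivAt (fun γ : ℝ => √ω - γ) (-1) 0 := (hasDerivAt_id (0 : ℝ)).const_sub _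
    have hi1 := hγ.fun_inv (by simpa using hs.ne')
    have hi2 := (hγ.fun_pow 2).fun_inv (by simpa using hs.ne')
    have d0 : HasDerivAt (fun γ : ℝ => profileParam ω α a b d₂ (γ, 0, 0, 0) 0) (√ω)⁻¹ 0 := by
      simp only [profileParam_line hω, Matrix.cons_val]
      refine ((hi1.const_mul (√ω)).sub_const 1).congr_deriv ?_
      simp
      field_simp
    have d2 : HasDerivAt (fun γ : ℝ => profileParam ω α a b d₂ (γ, 0, 0, 0) 2) (2 * (√ω ^ 3)⁻¹) 0 := by
      simp only [profileParam_line hω, Matrix.cons_val]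
      refine (hi2.const_mul 1).congr_deriv ?_
      simp
      field_simp
    have d4 : HasDerivAt (fun γ : ℝ => profileParam ω α a b d₂ (γ, 0, 0, 0) 4)
        (2 * α * (√ω ^ 3)⁻¹) 0 := by
      simp only [profileParam_line hω, Matrix.cons_val]
      refine (hi2.const_mul α).congr_deriv ?_
      simp
      field_simp
    have hline0 : Tendsto (fun γ : ℝ => ((γ, 0, 0, 0) : ℝ × ℝ × ℝ × ℝ)) (𝓝 0) (𝓝 0) :=
      hline.continuousAt.tendsto
    have e0 : u (0, 0, 0, 0) = (waveFI κ hκ, 0, 8 * ω / κ) := hu0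
    obtain ⟨x', hx', hid⟩ := profile_energy_deriv hf hg hY d0 d2 d4
      (by simp [profileParam_line hω, hs.ne'])
      (by simp [e0]) (Eventually.of_forall fun t => by simp [profileParam_line hω])
      (hline0.eventually hueq)
    have hx0' : amp (u (0, 0, 0, 0)).1 (u (0, 0, 0, 0)).2.2 onePt = 8 * ω / waveDen κ 1 := hx0
    simp only [Function.comp_apply, hx0', profileParam_line hω, Matrix.cons_val] at hid
    rw [e0] at hid
    have hx'' := wave_amplitude_deriv hω hκ (CI.prim (waveEnergyI ω κ hκ) onePt) (x' := x') (by
      rw [← hα, ← hα']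
      refine Eq.trans ?_ hid
      simp only [sub_zero, Real.sq_sqrt hω.le])
    have h3 := HasDerivAt.sqrt hx' (by simp only [Function.comp_apply]; rw [hx0']; rw [← hx0]; exact hx0pos.ne')
    refine h3.congr_deriv ?_
    simp only [Function.comp_apply]
    rw [hx0', hx'', hN, hR0]
    have hv := (waveV_neg hκ zero_le_one).ne
    have hr : √(8 * ω / waveDen κ 1) ≠ 0 := by
      rw [← hx0]
      exact (Real.sqrt_pos.2 hx0pos).ne'
    field_simp
  · have cRe : ContinuousAt (restRe ω a b) 0 := (contDiffAt_restRe (n := 0) hω).continuousAt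
    have cIm : ContinuousAt (restIm ω a b) 0 := (contDiffAt_restIm (n := 0) hω).continuousAt
    have cW : ContinuousAt (restW ω a b) 0 := (contDiffAt_restW (n := 0) 0).continuousAt
    have cσ : ContinuousAt (fun p : ℝ × ℝ × ℝ × ℝ => restRe ω a b p - p.1) 0 := cRe.sub continuousAt_fst
    have cσ' : ContinuousAt (fun p : ℝ × ℝ × ℝ × ℝ => restRe ω a b p + p.1) 0 := cRe.add continuousAt_fst
    have vRe : restRe ω a b 0 = √ω := restRe_line hω 0
    have vIm : restIm ω a b 0 = 0 := restIm_line 0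
    have vW : restW ω a b 0 = ω := restW_line 0
    have cu := huc.continuousAt
    have cslope : Tendsto (fun p => profileSlope (profileParam ω α a b d₂ p) (u p).1 (u p).2.1 (u p).2.2)
        (𝓝 0) (𝓝 (waveVI κ hκ)) := by
      rw [← profileSlope_wave hω hκ]
      have h1 := (continuous_profileSlope.tendsto (profileParam ω α a b d₂ 0, u 0)).comp
        (hlc.continuousAt.prodMk cu).tendsto
      rw [hl0, hu0] at h1
      exact h1
    -- Near the base point σ < 2√ω, so with this η one has exp(2ση) ≤ 2: up to z = η the variable q
    -- stays in [0, 2].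
    refine ⟨Real.log 2 / (4 * √ω), by have := Real.log_pos one_lt_two; positivity,
      2 * √ω + ‖waveFI κ hκ‖ + ‖amp (u 0).1 (u 0).2.2‖ + 1, ?_⟩
    have n1 := norm_nonneg (waveFI κ hκ)
    have n2 := norm_nonneg (amp (u 0).1 (u 0).2.2)
    have hlog := Real.log_pos one_lt_two
    filter_upwards [hueq, cW.eventually_const_lt (by rw [vW]; exact hω),
      cσ.eventually_const_lt (u := 0) (by simp [vRe, hs]),
      cσ'.eventually_const_lt (u := 0) (by simp [vRe, hs]),
      cσ.eventually_lt_const (u := 2 * √ω) (by simp [vRe]; linarith),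
      cIm.abs.eventually_lt_const (u := 1) (by simp [vIm]),
      eventually_neg_of_tendsto cslope (fun q => waveV_neg hκ q.2.1),
      cu.snd.snd.eventually_const_lt (u := 0) (by simp only [hu0]; positivity),
      cu.fst.norm.eventually_lt_const (u := ‖waveFI κ hκ‖ + 1) (by simp [hu0]),
      cu.snd.fst.norm.eventually_lt_const (u := 1) (by simp [hu0]),
      hAc.continuousAt.norm.eventually_lt_const (u := ‖amp (u 0).1 (u 0).2.2‖ + 1) (by simp)]
      with p h1 h2 h3 h4 h5 h6 h7 h8 h9 h10 h11
    refine ⟨(u p).1, (u p).2.1, (u p).2.2, ⟨h2, h3, h4, h1, h8, h7⟩, ?_, ?_, by linarith, by linarith,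
      by linarith, by linarith, rfl⟩
    · rw [← Real.le_log_iff_exp_le two_pos]
      have : 2 * (restRe ω a b p - p.1) * (Real.log 2 / (4 * √ω)) ≤
          2 * (2 * √ω) * (Real.log 2 / (4 * √ω)) := by gcongr
      refine this.trans_eq ?_
      field_simp
      norm_num
    · rw [abs_of_pos h3]
      linarith

/-! ### Differentiation in the wave speed and conclusion -/

/-- A perturbation that is quadratic in a differentiable phase vanishing at `0` does not change the
derivative at `0`. -/
theorem hasDerivAt_of_quadratic_error {F G τ : ℝ → ℝ} {G' M : ℝ} (hG : HasDerivAt G G' 0)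
    (hτ : DifferentiableAt ℝ τ 0) (hτ0 : τ 0 = 0)
    (h : ∀ᶠ c in 𝓝 (0 : ℝ), |F c - G c| ≤ M * τ c ^ 2) : HasDerivAt F G' 0 := by
  have hsq : HasDerivAt (fun c => M * τ c ^ 2) 0 0 := by
    refine ((hτ.hasDerivAt.pow 2).const_mul M).congr_deriv ?_
    simp [hτ0]
  have h0 : F 0 - G 0 = 0 := by
    have := h.self_of_nhds
    rw [hτ0] at this
    simpa using this
  have hd : HasDerivAt (fun c => F c - G c) 0 0 := by
    rw [hasDerivAt_iff_isLittleO] at hsq ⊢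
    refine Asymptotics.IsBigO.trans_isLittleO (Asymptotics.IsBigO.of_bound 1 ?_) hsq
    filter_upwards [h] with c hc
    simp only [h0, hτ0, smul_zero, sub_zero, Real.norm_eq_abs, one_mul]
    simpa using hc.trans (le_abs_self _)
  refine ((hd.add hG).congr_of_eventuallyEq (Eventually.of_forall fun c => ?_)).congr_deriv
    (zero_add _)
  simp

/-- The curve of parameters `(γ, μ, ε, e)` traced out as the wave speed `c` varies. -/
theorem hasDerivAt_param (P : PCQParams) :
    HasDerivAt (fun c : ℝ => ((c / (2 * P.Δ) * P.ε * P.a, c ^ 2, P.ε, P.ε * P.d₁) : ℝ × ℝ × ℝ × ℝ))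
      (P.ε * P.a / (2 * P.Δ), 0, 0, 0) 0 := by
  have h1 : HasDerivAt (fun c : ℝ => c / (2 * P.Δ) * P.ε * P.a) (P.ε * P.a / (2 * P.Δ)) 0 := by
    refine ((((hasDerivAt_id (0 : ℝ)).div_const (2 * P.Δ)).mul_const P.ε).mul_const P.a).congr_deriv ?_
    ring
  have h2 : HasDerivAt (fun c : ℝ => c ^ 2) 0 0 := by simpa using hasDerivAt_pow 2 (0 : ℝ)
  exact h1.prodMk (h2.prodMk ((hasDerivAt_const _ _).prodMk (hasDerivAt_const _ _)))

/-- The prefactor εa already carries one order. The second comes from the error in T and from Δ - 1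
= ε²a² ≤ εa². -/
theorem abs_deriv_sub_le {T N ε a Δ K D : ℝ} (hε : 0 < ε) (hε1 : ε ≤ 1)
    (hΔ : Δ = 1 + ε ^ 2 * a ^ 2) (hT : |T - 2 * N| ≤ K * (ε * (1 + D))) :
    |ε * a / (2 * Δ) * T - N * a * ε| ≤ |a| * (K * (1 + D) + |N| * a ^ 2) * ε ^ 2 := by
  have hΔ1 : 1 ≤ Δ := by rw [hΔ]; nlinarith [sq_nonneg (ε * a)]
  have h1 : ε * a / (2 * Δ) * T - N * a * ε = ε * a * (((T - 2 * N) - 2 * N * (Δ - 1)) / (2 * Δ)) := by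
    field_simp
    ring
  have h2 : |(T - 2 * N) - 2 * N * (Δ - 1)| ≤ K * (ε * (1 + D)) + 2 * |N| * (ε * a ^ 2) := by
    refine (abs_sub _ _).trans (add_le_add hT ?_)
    rw [abs_mul, abs_mul, abs_two, abs_of_nonneg (by linarith : 0 ≤ Δ - 1), hΔ]
    have : ε ^ 2 ≤ ε := by nlinarith
    have h3 : 1 + ε ^ 2 * a ^ 2 - 1 ≤ ε * a ^ 2 := by nlinarith [sq_nonneg a]
    exact mul_le_mul_of_nonneg_left h3 (by positivity)
  have h0 : 0 ≤ K * (ε * (1 + D)) := (abs_nonneg _).trans hT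
  have h3 : |((T - 2 * N) - 2 * N * (Δ - 1)) / (2 * Δ)| ≤ K * (ε * (1 + D)) + |N| * (ε * a ^ 2) := by
    rw [abs_div, abs_of_pos (by linarith : 0 < 2 * Δ), div_le_iff₀ (by linarith)]
    have h4 : 0 ≤ |N| * (ε * a ^ 2) := by positivity
    nlinarith
  rw [h1, abs_mul, abs_mul, abs_of_pos hε]
  calc ε * |a| * _ ≤ ε * |a| * (K * (ε * (1 + D)) + |N| * (ε * a ^ 2)) :=
        mul_le_mul_of_nonneg_left h3 (by positivity)
    _ = _ := by ring

theorem mainTheorem8 (ω α a b d₂ : ℝ) (hω : 0 < ω) (hβ : -(16 / 3) * α * ω < 1) :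
    waveN ω α < 0 ∧
    ∀ D : ℝ, 0 < D → ∃ ε₀ > 0, ∃ δ > 0, ∃ η > 0, ∃ K : ℝ,
      ∀ ε d₁ : ℝ, 0 < ε → ε < ε₀ → |d₁| ≤ D →
        -- the unstable manifold, with phase fixed by `s = 0` at `z = 0`, exists
        (∀ c : ℝ, |c| < δ → ∃ u : ℝ → ℝ × ℝ × ℝ,
          PCQParams.IsUnstableOrbit ⟨ω, α, ε, a, b, d₁, d₂⟩ c η u ∧ FirstCrossing η u 0) ∧
        -- its `r`-component at `z = 0` has a `c`-derivative at `c = 0`, the same one for every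
        -- choice of phase that is differentiable in `c`, with the stated expansion
        ∃ rc : ℝ, |rc - waveN ω α * a * ε| ≤ K * ε ^ 2 ∧
          ∀ (η' : ℝ) (W : ℝ → ℝ → ℝ × ℝ × ℝ) (τ : ℝ → ℝ), 0 < η' →
            (∀ᶠ c in 𝓝 (0 : ℝ),
              PCQParams.IsUnstableOrbit ⟨ω, α, ε, a, b, d₁, d₂⟩ c η' (W c) ∧
                FirstCrossing η' (W c) (τ c)) →
            τ 0 = 0 → DifferentiableAt ℝ τ 0 →
            HasDerivAt (fun c => (W c 0).1) rc 0 := by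
  refine ⟨waveN_neg hω hβ, fun D hD => ?_⟩
  obtain ⟨ρ, hρ, hρ', η, hη, C, hfam⟩ := exists_orbit_family a b d₂ hω hβ
  have hline : HasDerivAt (fun γ : ℝ => ((γ, 0, 0, 0) : ℝ × ℝ × ℝ × ℝ)) (1, 0, 0, 0) 0 :=
    (hasDerivAt_id _).prodMk (hasDerivAt_const _ _)
  have hT0 : fderiv ℝ ρ 0 (1, 0, 0, 0) = 2 * waveN ω α :=
    ((hρ.differentiableAt two_ne_zero).hasFDerivAt.comp_hasDerivAt (0 : ℝ) hline).unique hρ'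
  -- Second-order smoothness is used here: the derivative of ρ varies by O(‖p‖) near 0, which
  -- produces the remainder O(ε²).
  have hfd : ContDiffAt ℝ 1 (fderiv ℝ ρ) 0 := hρ.fderiv_right (by norm_num)
  obtain ⟨K₀, hK₀⟩ := (hfd.differentiableAt one_ne_zero).isBigO_sub.bound
  have hdiff : ∀ᶠ p in 𝓝 (0 : ℝ × ℝ × ℝ × ℝ), DifferentiableAt ℝ ρ p :=
    (hρ.eventually (by simp)).mono fun p hp => hp.differentiableAt two_ne_zero
  obtain ⟨r, hr, hball⟩ := Metric.eventually_nhds_iff_ball.1 ((hfam.and hdiff).and hK₀)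
  have ha := abs_nonneg a
  -- These bounds keep the parameter point in the ball of radius r: |γ| ≤ ε|a|, |e| ≤ εD, and c² ≤
  -- |c| because |c| < 1.
  refine ⟨min 1 (r / (1 + D + |a|)), by positivity, min 1 r, by positivity, η, hη,
    |a| * (|K₀| * (1 + D) + |waveN ω α| * a ^ 2), fun ε d₁ hε hε₀ hd₁ => ?_⟩
  set P : PCQParams := ⟨ω, α, ε, a, b, d₁, d₂⟩ with hP
  have hε1 : ε < 1 := hε₀.trans_le (min_le_left _ _)
  have hεr : ε * (1 + D + |a|) < r :=
    (lt_div_iff₀ (by positivity)).1 (hε₀.trans_le (min_le_right _ _))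
  have hεa : 0 ≤ ε * |a| := by positivity
  have hεD : 0 < ε * D := by positivity
  have hed : |ε * d₁| ≤ ε * D := by
    rw [abs_mul, abs_of_pos hε]
    exact mul_le_mul_of_nonneg_left hd₁ hε.le
  have hΔ : P.Δ = 1 + ε ^ 2 * a ^ 2 := rfl
  have hΔ0 := P.Δ_pos
  have hΔ1 : 1 ≤ P.Δ := by rw [hΔ]; nlinarith [sq_nonneg (ε * a)]
  set q : ℝ → ℝ × ℝ × ℝ × ℝ := fun c => (c / (2 * P.Δ) * ε * a, c ^ 2, ε, ε * d₁) with hq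
  have hk : ∀ c : ℝ, |c / (2 * P.Δ)| ≤ |c| := fun c => by
    rw [abs_div, abs_of_pos (by positivity : 0 < 2 * P.Δ)]
    exact div_le_self (abs_nonneg c) (by linarith)
  have hck : ∀ c : ℝ, 2 * P.Δ * (c / (2 * P.Δ)) = c := fun c => by field_simp
  have hmem : ∀ c : ℝ, |c| < min 1 r → q c ∈ Metric.ball 0 r := by
    intro c hc
    have hc1 : |c| < 1 := hc.trans_le (min_le_left _ _)
    have hcr : |c| < r := hc.trans_le (min_le_right _ _)
    rw [mem_ball_zero_iff]
    simp only [hq, Prod.norm_def, Real.norm_eq_abs, sup_lt_iff]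
    refine ⟨?_, ?_, ?_, ?_⟩
    · rw [abs_mul, abs_mul, abs_of_pos hε]
      have h1 : |c / (2 * P.Δ)| * ε * |a| ≤ 1 * ε * |a| := by
        have := (hk c).trans hc1.le
        gcongr
      nlinarith
    · rw [abs_pow]
      nlinarith [abs_nonneg c]
    · rw [abs_of_pos hε]
      nlinarith
    · nlinarith
  have hprof : ∀ c : ℝ, |c| < min 1 r → ∃ (σ S ψ : ℝ) (l : Fin 6 → ℝ) (f g : CI) (Y : ℝ),
      IsProfile P (c / (2 * P.Δ)) σ S ψ l f g Y ∧ 0 < S + c / (2 * P.Δ) * P.ε * P.a ∧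
      Real.exp (2 * σ * η) ≤ 2 ∧ (profileOrbit σ ψ (c / (2 * P.Δ)) f g Y 0).1 = ρ (q c) ∧
      ∀ z < η, ‖profileOrbit σ ψ (c / (2 * P.Δ)) f g Y z‖ ≤ (2 * max C 1 + 1) ^ 2 := by
    intro c hc
    obtain ⟨⟨⟨f, g, Y, ⟨h1, h2, h3, h4, h5, h6⟩, h7, h8, h9, h10, h11, h12, h13⟩, -⟩, -⟩ :=
      hball _ (hmem c hc)
    have hpr : IsProfile P (c / (2 * P.Δ)) _ _ _ _ f g Y :=
      isProfile_of_param (P := P) rfl rfl rfl rfl rfl (by rw [hck]) h1 h2 h4 h5 h6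
    refine ⟨_, _, _, _, f, g, Y, hpr, h3, h7, by rw [profileOrbit_zero_fst, h13], fun z hz => ?_⟩
    have hm := le_max_left C 1
    refine norm_profileOrbit_le (h10.trans hm) (h11.trans hm) (h12.trans hm) (h8.trans hm)
      (h9.trans hm) (((hk c).trans (hc.le.trans (min_le_left _ _))).trans (le_max_right C 1)) ?_
    refine (Real.exp_le_exp.2 ?_).trans h7
    exact mul_le_mul_of_nonneg_left hz.le (by positivity)
  refine ⟨fun c hc => ?_, fderiv ℝ ρ (q 0) (ε * a / (2 * P.Δ), 0, 0, 0), ?_, ?_⟩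
  · obtain ⟨σ, S, ψ, l, f, g, Y, hpr, -, hσ, -⟩ := hprof c hc
    refine ⟨_, ?_, hpr.firstCrossing hη⟩
    have := hpr.isUnstableOrbit hσ
    rwa [hck] at this
  · have hvec : ((ε * a / (2 * P.Δ), 0, 0, 0) : ℝ × ℝ × ℝ × ℝ) =
        (ε * a / (2 * P.Δ)) • (1, 0, 0, 0) := by simp
    rw [hvec, map_smul, smul_eq_mul]
    refine abs_deriv_sub_le hε hε1.le hΔ ?_
    have hq0 := hmem 0 (by rw [abs_zero]; positivity)
    have h1 := (hball _ hq0).2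
    have h2 := ContinuousLinearMap.le_opNorm (fderiv ℝ ρ (q 0) - fderiv ℝ ρ 0) (1, 0, 0, 0)
    have h3 : ‖((1, 0, 0, 0) : ℝ × ℝ × ℝ × ℝ)‖ = 1 := by simp [Prod.norm_def]
    rw [sub_apply, hT0, h3, mul_one, Real.norm_eq_abs] at h2
    have h4 : ‖q 0‖ ≤ ε * (1 + D) := by
      simp only [hq, Prod.norm_def, Real.norm_eq_abs, sup_le_iff]
      refine ⟨?_, ?_, ?_, ?_⟩
      · simp; positivity
      · simp; positivity
      · rw [abs_of_pos hε]
        nlinarith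
      · nlinarith
    calc _ ≤ _ := h2
      _ ≤ K₀ * ‖q 0‖ := by simpa using h1
      _ ≤ |K₀| * ‖q 0‖ := mul_le_mul_of_nonneg_right (le_abs_self _) (norm_nonneg _)
      _ ≤ _ := mul_le_mul_of_nonneg_left h4 (abs_nonneg _)
  · intro η' W τ hη' hW hτ0 hτ
    have hq0 := hmem 0 (by rw [abs_zero]; positivity)
    have hG : HasDerivAt (fun c => ρ (q c)) (fderiv ℝ ρ (q 0) (ε * a / (2 * P.Δ), 0, 0, 0)) 0 :=
      (hball _ hq0).1.2.hasFDerivAt.comp_hasDerivAt (0 : ℝ) (hasDerivAt_param P)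
    set B := (2 * max C 1 + 1) ^ 2 with hB
    have hcont : Continuous fun x : ℝ × ℝ × ℝ × ℝ => P.field x.1 x.2 := by
      unfold PCQParams.field
      fun_prop
    obtain ⟨M, hM⟩ := (isCompact_closedBall (0 : ℝ × ℝ × ℝ × ℝ) (max 1 B)).exists_bound_of_continuousOn
      hcont.continuousOn
    -- B bounds the orbits and M the field on a ball containing every (c, orbit point), so one
    -- constant serves for all small c.
    refine hasDerivAt_of_quadratic_error (M := B * M) hG hτ hτ0 ?_
    have hτc : Tendsto τ (𝓝 0) (𝓝 0) := by
      have := hτ.continuousAt.tendsto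
      rwa [hτ0] at this
    filter_upwards [hW, Metric.ball_mem_nhds (0 : ℝ) (by positivity : 0 < min 1 r),
      hτc.eventually_const_lt (neg_lt_zero.2 hη)] with c hc hcr hcτ
    have hcr' : |c| < min 1 r := by simpa using hcr
    obtain ⟨σ, S, ψ, l, f, g, Y, hpr, hS, hσ, hρc, hBd⟩ := hprof c hcr'
    have hWc : P.IsUnstableOrbit (2 * P.Δ * (c / (2 * P.Δ))) η' (W c) := by
      rw [hck]
      exact hc.1
    rw [hpr.apply_zero_eq hS hη hσ hη' hWc hc.2 (by linarith), ← hρc, ← neg_sq (τ c)]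
    have hor := hpr.isUnstableOrbit hσ
    refine abs_fst_sub_le P hor.1 hBd (fun z hz => ?_) (hpr.firstCrossing hη).2.1 hη (by linarith)
    refine hM (2 * P.Δ * (c / (2 * P.Δ)), _) ?_
    rw [mem_closedBall_zero_iff, hck]
    exact norm_prod_le_iff.2 ⟨(hcr'.le.trans (min_le_left _ _)).trans (le_max_left _ _),
      (hBd z hz).trans (le_max_right _ _)⟩
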